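/- **Setting.** Let $N=[n]$ be a set of agents, $v:2^N\to\mathbb{R}_{\ge 0}$ a normalised ($v(\emptyset)=0$), non-negative, possibly non-monotone submodular function, $c_i>0$ the cost of agent $i$, and $B>0$ a budget. Write $v(i\mid S)=v(S\cup\{i\})-v(S)$, $v(i)=v(\{i\})$, and let $S^*$ be an optimal solution of $\max\{v(S): S\subseteq N,\ \sum_{i\in S}c_i\le B\}$. Agents arrive in uniformly random order, and a prediction $\omega$ of $v(S^*)$ is given. **Mechanism $M$**, with parameters $q\in[0,1]$, $a,\beta\ge 0$ and real $k\ge 1$. Fix a strict ranking of the agents by their values $v(i)$, ties being broken consistently in an arbitrary way. * With probability $q$ (Dynkin's algorithm): observe the first $\lfloor n/e\rfloor$ agents; then hire the first later agent that is ranked at least as high as all of the observed ones (if there is one) and pay her $B$. The output $A$ consists of this agent, or is empty. * With probability $1-q$: draw $\xi$ from the binomial distribution $\mathcal{B}(n,1/k)$, and let $N_1$ be the set of the first $\xi$ agents and $N_2=N\setminus N_1$. Let $T_1\subseteq N_1$ be any $\frac1e$-approximate solution on $N_1$, that is, $\sum_{i\in T_1}c_i\le B$ and $v(T_1)\ge \frac1e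 v(S)$ for all $S\subseteq N_1$ with $\sum_{i\in S}c_i\le B$. Set $t=a\,\omega+\beta\, v(T_1)$, $S_1=S_2=\emptyset$, $B_1=B_2=B$, and draw $j\in\{1,2\}$ uniformly. When an agent $i\in N_2$ arrives, let $j(i)\in\arg\max_{l\in\{1,2\}}v(i\mid S_l)$ (ties broken arbitrarily) and $\bar p_i=\frac{B}{t}v(i\mid S_{j(i)})$; if $c_i\le\bar p_i$ and $B_{j(i)}-\bar p_i\ge 0$, add $i$ to $S_{j(i)}$ with payment $\bar p_i$ and decrease $B_{j(i)}$ by $\bar p_i$. The output is $A=S_j$; agents outside $S_j$ are paid $0$. All these draws are independent of each other and of the arrival order, and $\mathbb{E}[v(A)]$ is taken over the arrival order and all draws. **Theorem.** Let $\varepsilon\in[0,1)$, $\omega=(1-\varepsilon)\,v(S^*)$, $\delta>0$ and $z>0$. Put $$L_\varepsilon= a(1-\varepsilon)+\tfrac{\beta}{e}\big(\tfrac1k-\delta\big),\qquad \tilde p_\varepsilon=1-2\exp\!\left(-\frac{\delta^2/2}{\big(\frac{k-1}{k^2}+\frac{\delta}{3}\big)\cdot\frac1z\cdot L_\varepsilon}\right),$$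 $$\rho(\varepsilon)=\min\left\{\frac{q}{e z}L_\varepsilon,\ (1-q)\,\tilde p_\varepsilon\cdot\min\!\left(\tfrac14\big(\tfrac{k-1}{k}-\delta\big)-\tfrac12\big(a(1-\varepsilon)+\beta\big),\ \tfrac{z-1}{2z}L_\varepsilon\right)\right\}.$$ If $\tilde p_\varepsilon\ge 0$ (with the convention $x/0=0$ in the case $L_\varepsilon=0$), then $\mathbb{E}[v(A)]\ge\rho(\varepsilon)\cdot v(S^*)$ on every instance. **Corollary.** For $q=0.61$, $a=0.035$, $\beta=0.155$, $k=2.5$, the choice $z=2.47$, $\delta=0.164$ gives $\rho(0)\ge\frac1{228}$ and $\rho(\varepsilon)\ge\frac1{818}$ for all $\varepsilon\in[0,1)$. With these parameters, $M$ is $228$-consistent, that is, $228\cdot\mathbb{E}[v(A)]\ge v(S^*)$ on every instance with $\omega=v(S^*)$; and it is $818$-robust, that is, $818\cdot\mathbb{E}[v(A)]\ge v(S^*)$ on every instance with an arbitrary $\omega\in(0,v(S^*)]$. -/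

import Mathlib

/-- A budget-feasible procurement instance with agents `Fin n`: a normalised, non-negative,
(possibly non-monotone) submodular valuation `v`, positive costs `c` and a budget `B > 0`. -/
structure Instance (n : ℕ) where
  v : Finset (Fin n) → ℝ
  c : Fin n → ℝ
  B : ℝ
  v_nonneg : ∀ S, 0 ≤ v S
  v_empty : v ∅ = 0
  submodular : ∀ S T : Finset (Fin n), S ⊆ T → ∀ i, i ∉ T →
    v (insert i T) - v T ≤ v (insert i S) - v S
  c_pos : ∀ i, 0 < c i
  B_pos : 0 < B

namespace Instance

variable {n : ℕ} (I : Instance n)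

/-- The marginal value `v(i | S)`. -/
def marginal (i : Fin n) (S : Finset (Fin n)) : ℝ := I.v (insert i S) - I.v S

/-- `S` is an affordable set of agents: `∑_{i ∈ S} c_i ≤ B`. -/
def Feasible (S : Finset (Fin n)) : Prop := ∑ i ∈ S, I.c i ≤ I.B

/-- `S` is an optimal solution of `max v(S)` subject to `∑_{i ∈ S} c_i ≤ B`, `S ⊆ N`. -/
def IsOptimal (S : Finset (Fin n)) : Prop :=
  I.Feasible S ∧ ∀ T, I.Feasible T → I.v T ≤ I.v S

/-- `T` is an `r`-approximate solution of the same problem restricted to the agents in `N₁`. -/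
def IsApproxOn (r : ℝ) (N₁ T : Finset (Fin n)) : Prop :=
  T ⊆ N₁ ∧ I.Feasible T ∧ ∀ S, S ⊆ N₁ → I.Feasible S → r * I.v S ≤ I.v T

end Instance

/-- The choices that the description of the mechanism leaves open on the instance `I`:
the strict ranking of the agents by value (ties broken consistently, in any way), the
`1/e`-approximate solution `T₁` for each possible sample `N₁`, and the maximiser
`j(i) ∈ argmax_j v(i | S_j)` for each pair `(S₁, S₂)` and each agent `i`. -/
structure Choices {n : ℕ} (I : Instance n) where
  rank : Fin n → ℕ
  rank_injective : Function.Injective rank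
  rank_lt : ∀ i j, I.v {i} < I.v {j} → rank i < rank j
  approx : Finset (Fin n) → Finset (Fin n)
  approx_spec : ∀ N₁, I.IsApproxOn (1 / Real.exp 1) N₁ (approx N₁)
  pick : (Fin 2 → Finset (Fin n)) → Fin n → Fin 2
  pick_spec : ∀ (S : Fin 2 → Finset (Fin n)) i j, I.marginal i (S j) ≤ I.marginal i (S (pick S i))

theorem Instance.exists_optimalOn {n : ℕ} (I : Instance n) (N₁ : Finset (Fin n)) :
    ∃ T, T ⊆ N₁ ∧ I.Feasible T ∧ ∀ S, S ⊆ N₁ → I.Feasible S → I.v S ≤ I.v T := by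
  classical
  obtain ⟨T, hT, h⟩ := (N₁.powerset.filter fun S => I.Feasible S).exists_max_image I.v
    ⟨∅, by
      rw [Finset.mem_filter]
      exact ⟨Finset.empty_mem_powerset _, by simp [Instance.Feasible, I.B_pos.le]⟩⟩
  simp only [Finset.mem_filter, Finset.mem_powerset] at hT h
  exact ⟨T, hT.1, hT.2, fun S h1 h2 => h S ⟨h1, h2⟩⟩

theorem Instance.exists_isOptimal {n : ℕ} (I : Instance n) : ∃ S, I.IsOptimal S := by
  obtain ⟨T, _, h, h'⟩ := I.exists_optimalOn Finset.univ
  exact ⟨T, h, fun S hS => h' S (Finset.subset_univ _) hS⟩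

/-- Every instance admits such choices. -/
theorem Choices.nonempty {n : ℕ} (I : Instance n) : Nonempty (Choices I) := by
  classical
  choose ap h1 h2 h3 using I.exists_optimalOn
  have hp : ∀ (S : Fin 2 → Finset (Fin n)) i, ∃ j', ∀ j, I.marginal i (S j) ≤ I.marginal i (S j') :=
    fun S i => Finite.exists_max fun j => I.marginal i (S j)
  choose pk hpk using hp
  let key : Fin n → ℝ ×ₗ Fin n := fun i => toLex (I.v {i}, i)
  have hk : Function.Injective key := fun i j h => (congrArg (fun x => (ofLex x).2) h : _)
  let rk : Fin n → ℕ := fun i => (Finset.univ.filter fun j => key j < key i).card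
  have hr : ∀ i j, key i < key j → rk i < rk j := by
    intro i j h
    apply Finset.card_lt_card
    rw [Finset.ssubset_iff_of_subset]
    · exact ⟨i, by simp [h], by simp⟩
    · intro x hx
      simp only [Finset.mem_filter, Finset.mem_univ, true_and] at hx ⊢
      exact hx.trans h
  refine ⟨⟨rk, ?_, ?_, ap, ?_, pk, hpk⟩⟩
  · intro i j h
    rcases lt_trichotomy (key i) (key j) with h' | h' | h'
    · exact absurd h (hr _ _ h').ne
    · exact hk h'
    · exact absurd h (hr _ _ h').ne'
  · intro i j h
    exact hr _ _ (Prod.Lex.toLex_lt_toLex.2 (Or.inl h))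
  · intro N₁
    refine ⟨h1 N₁, h2 N₁, fun S a b => le_trans ?_ (h3 N₁ S a b)⟩
    have : 1 / Real.exp 1 ≤ 1 := by
      rw [div_le_one (Real.exp_pos 1)]; exact Real.one_le_exp (by norm_num)
    nlinarith [I.v_nonneg S]

/-- The result of a (deterministic) run: the set of hired agents and the payments. -/
structure Outcome (n : ℕ) where
  winners : Finset (Fin n)
  pay : Fin n → ℝ

/-- The state of the posted-price loop: the two solutions, their remaining budgets, and the
posted prices accepted so far. -/
structure LoopState (n : ℕ) where
  sol : Fin 2 → Finset (Fin n)
  bud : Fin 2 → ℝ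
  price : Fin n → ℝ

/-- The parameters of the mechanism: the probability `q` of running Dynkin's algorithm, the
weights `a`, `β` of the prediction and of the sample in the threshold, and `k`, where `1/k` is the
sampling rate. -/
structure Params where
  q : ℝ
  a : ℝ
  β : ℝ
  k : ℝ

noncomputable section

namespace Mechanism

variable {n : ℕ} {I : Instance n}

/-- The agents in their order of arrival `σ 0, σ 1, …, σ (n-1)`. -/
def arrivals (σ : Equiv.Perm (Fin n)) : List (Fin n) := List.ofFn σ

/-- Dynkin's algorithm: observe the first `⌊n/e⌋` agents, then hire the first later agent that is
ranked at least as high as all of them (if there is one) and pay her `B`. -/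
def dynkin (C : Choices I) (σ : Equiv.Perm (Fin n)) : Outcome n :=
  let r := ⌊(n : ℝ) / Real.exp 1⌋₊
  let sample := (arrivals σ).take r
  let W := (((arrivals σ).drop r).find? fun j => decide (∀ i ∈ sample, C.rank i ≤ C.rank j)).toFinset
  { winners := W, pay := fun i => if i ∈ W then I.B else 0 }

open Classical in
/-- The arrival of agent `i` in the posted-price loop with threshold `t`: she is offered
`(B/t) · v(i | S_{j(i)})`, and joins `S_{j(i)}` if her cost is at most this price and the price is
at most the remaining budget `B_{j(i)}`. -/
def step (C : Choices I) (t : ℝ) (s : LoopState n) (i : Fin n) : LoopState n :=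
  let j := C.pick s.sol i
  let p := I.B / t * I.marginal i (s.sol j)
  if I.c i ≤ p ∧ 0 ≤ s.bud j - p then
    { sol := Function.update s.sol j (insert i (s.sol j))
      bud := Function.update s.bud j (s.bud j - p)
      price := Function.update s.price i p }
  else s

/-- The threshold `t = a ω + β v(T₁)`, where `N₁` is the set of the first `ξ` agents and `T₁` is the
`1/e`-approximate solution on `N₁`. -/
def threshold (P : Params) (C : Choices I) (ω : ℝ) (σ : Equiv.Perm (Fin n)) (ξ : ℕ) : ℝ :=
  P.a * ω + P.β * I.v (C.approx ((arrivals σ).take ξ).toFinset)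

/-- The posted-price branch for arrival order `σ`, sample size `ξ` and drawn index `j`: run the loop
on all agents after the first `ξ`, return `S_j`, and pay only its members. -/
def posted (P : Params) (C : Choices I) (ω : ℝ) (σ : Equiv.Perm (Fin n)) (ξ : ℕ) (j : Fin 2) :
    Outcome n :=
  let s := ((arrivals σ).drop ξ).foldl (step C (threshold P C ω σ ξ))
    { sol := fun _ => ∅, bud := fun _ => I.B, price := fun _ => 0 }
  { winners := s.sol j, pay := fun i => if i ∈ s.sol j then s.price i else 0 }

/-- The probability of the value `ξ` under the binomial distribution `𝓑(n, 1/k)`. -/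
def binomialWeight (n : ℕ) (k : ℝ) (ξ : ℕ) : ℝ :=
  (n.choose ξ : ℝ) * (1 / k) ^ ξ * (1 - 1 / k) ^ (n - ξ)

/-- `𝔼[v(A)]` for the mechanism on `I` with prediction `ω`: the arrival order is uniformly random;
with probability `q` Dynkin's algorithm is run, and with probability `1 - q` the posted-price branch,
with `ξ ∼ 𝓑(n, 1/k)` and `j` uniform on two values, all draws being independent. -/
def expectedValue (P : Params) (C : Choices I) (ω : ℝ) : ℝ :=
  ∑ σ : Equiv.Perm (Fin n), (1 / (n.factorial : ℝ)) *
    (P.q * I.v (dynkin C σ).winners +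
      (1 - P.q) * ∑ ξ ∈ Finset.range (n + 1), binomialWeight n P.k ξ *
        ∑ j : Fin 2, (1 / 2 : ℝ) * I.v (posted P C ω σ ξ j).winners)

/-- The mechanism with parameters `P` is `α`-consistent: `α · 𝔼[v(A)] ≥ v(S*)` on every instance
with the perfect prediction `ω = v(S*)`. -/
def IsConsistent (P : Params) (α : ℝ) : Prop :=
  ∀ (n : ℕ) (I : Instance n) (C : Choices I) (Sopt : Finset (Fin n)), I.IsOptimal Sopt →
    I.v Sopt ≤ α * expectedValue P C (I.v Sopt)

/-- The mechanism with parameters `P` is `ρ`-robust: `ρ · 𝔼[v(A)] ≥ v(S*)` on every instance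
with an arbitrary prediction `ω ∈ (0, v(S*)]`. -/
def IsRobust (P : Params) (ρ : ℝ) : Prop :=
  ∀ (n : ℕ) (I : Instance n) (C : Choices I) (Sopt : Finset (Fin n)), I.IsOptimal Sopt →
    ∀ ω : ℝ, 0 < ω → ω ≤ I.v Sopt → I.v Sopt ≤ ρ * expectedValue P C ω

/-- `a (1 - ε) + (β / e) (1/k - δ)`. -/
def level (P : Params) (δ ε : ℝ) : ℝ :=
  P.a * (1 - ε) + P.β / Real.exp 1 * (1 / P.k - δ)

/-- The quantity `p̃`. -/
def pTilde (P : Params) (δ z ε : ℝ) : ℝ :=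
  1 - 2 * Real.exp
    (-((δ ^ 2 / 2) / (((P.k - 1) / P.k ^ 2 + δ / 3) * (1 / z) * level P δ ε)))

/-- The approximation guarantee as a function of the parameters and the error `ε`. -/
def guarantee (P : Params) (δ z ε : ℝ) : ℝ :=
  min (P.q / (Real.exp 1 * z) * level P δ ε)
    ((1 - P.q) * pTilde P δ z ε *
      min (1 / 4 * ((P.k - 1) / P.k - δ) - 1 / 2 * (P.a * (1 - ε) + P.β))
        ((z - 1) / (2 * z) * level P δ ε))

end Mechanism

end

/-! Compare the most valuable single agent with `(L/z) · v(S*)`, where `L` is `level P δ ε`.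

If some agent is worth more than this, Dynkin's branch suffices. It hires the top-ranked agent with
probability at least `1/e` for every `n` (`card_dynkin_winners_eq`), which gives the term `q L / (e
z)`.

Otherwise every agent is small and the posted-price branch is analysed. Adding the elements of `S*`
one at a time yields a modular minorant of `v`, exact at `S*`, with weights in `[0, (L/z) v(S*)]`;
they are non-negative by optimality of `S*`, although `v` need not be monotone. The sample contains
each agent independently with probability `1/k`, so Bernstein's inequality for these weights
(`bernoulli_two_sided`) shows that with probability at least `p̃` both `S* ∩ N₁` and `S* ∩ N₂` keep
their share of `v(S*)` up to `δ`. Then `t` lies between `L v(S*)` and `(a(1-ε)+β) v(S*)`.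

For a fixed order (`LoopInvariant.value_ge`), either some agent was refused for lack of budget, and
one solution is worth more than `t` minus her value, or all refused agents have small marginals per
unit of cost. In the latter case the disjointness of the two solutions gives `v(S₁) + v(S₂) ≥ v(S* ∩
N₂)/2 - t`. Averaging over `j` halves both bounds and produces the inner minimum of `guarantee`. -/

namespace Instance

/-! ### Submodular inequalities and modular minorants. -/

variable {n : ℕ} (I : Instance n)

theorem marginal_anti {S T : Finset (Fin n)} (h : S ⊆ T) {i : Fin n} (hi : i ∉ T) :
    I.marginal i T ≤ I.marginal i S :=
  I.submodular S T h i hi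

theorem marginal_le_singleton {S : Finset (Fin n)} {i : Fin n} (hi : i ∉ S) :
    I.marginal i S ≤ I.v {i} := by
  have h := I.marginal_anti (Finset.empty_subset S) hi
  simpa [marginal, I.v_empty] using h

theorem v_union_sub_le_sum_marginal (A D : Finset (Fin n)) (h : Disjoint A D) :
    I.v (A ∪ D) - I.v A ≤ ∑ i ∈ D, I.marginal i A := by
  induction D using Finset.induction_on with
  | empty => simp
  | insert a D ha ih =>
    rw [Finset.disjoint_insert_right] at h
    rw [Finset.sum_insert ha, Finset.union_insert]
    have h1 := I.marginal_anti (i := a) (Finset.subset_union_left (s₁ := A) (s₂ := D))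
      (by simp [h.1, ha])
    have h2 := ih h.2
    simp only [marginal] at h1 h2 ⊢
    linarith

theorem v_union_sub_anti {X Y : Finset (Fin n)} (hXY : X ⊆ Y) (D : Finset (Fin n))
    (h : Disjoint Y D) : I.v (Y ∪ D) - I.v Y ≤ I.v (X ∪ D) - I.v X := by
  induction D using Finset.induction_on with
  | empty => simp
  | insert a D ha ih =>
    rw [Finset.disjoint_insert_right] at h
    rw [Finset.union_insert, Finset.union_insert]
    have h1 := I.submodular (X ∪ D) (Y ∪ D) (Finset.union_subset_union_left hXY) a
      (by simp [h.1, ha])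
    linarith [ih h.2]

/-- Two disjoint sets cannot both destroy the value of `O`. -/
theorem v_le_union_add_union (O : Finset (Fin n)) {S T : Finset (Fin n)} (h : Disjoint S T) :
    I.v O ≤ I.v (S ∪ O) + I.v (T ∪ O) := by
  -- `T \ O` adds at least as much to `O` as to `S ∪ O`, that is, `v(S ∪ O) + v(T ∪ O) ≥ v(O) + v(S
  -- ∪ T ∪ O)`; the last value is non-negative.
  have h1 := I.v_union_sub_anti (Finset.subset_union_right (s₁ := S) (s₂ := O)) (T \ O)
    (by
      rw [Finset.disjoint_union_left]
      exact ⟨h.mono_right Finset.sdiff_subset, Finset.disjoint_sdiff⟩)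
  rw [Finset.union_sdiff_self_eq_union, Finset.union_comm O T] at h1
  linarith [I.v_nonneg (S ∪ O ∪ T \ O)]

/-- A modular lower bound on `v` over the subsets of `S`, exact at `S`. -/
theorem exists_modular_minorant (S : Finset (Fin n)) :
    ∃ w : Fin n → ℝ, ∑ i ∈ S, w i = I.v S ∧ (∀ A ⊆ S, ∑ i ∈ A, w i ≤ I.v A) ∧
      ∀ i ∈ S, I.v S - I.v (S.erase i) ≤ w i ∧ w i ≤ I.v {i} := by
  induction S using Finset.induction_on with
  | empty =>
    refine ⟨0, by simp [I.v_empty], fun A hA => ?_, by simp⟩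
    simpa using I.v_nonneg A
  | insert a S ha ih =>
    obtain ⟨w, h1, h2, h3⟩ := ih
    have key : ∀ A : Finset (Fin n), a ∉ A →
        ∑ i ∈ A, Function.update w a (I.marginal a S) i = ∑ i ∈ A, w i := fun A hA =>
      Finset.sum_congr rfl fun i hi => Function.update_of_ne (by rintro rfl; exact hA hi) _ _
    -- Each weight is the marginal at the moment its element is added. Later additions only decrease
    -- the marginal `v(S) - v(S \ {i})`, so the lower bound on earlier weights persists.
    refine ⟨Function.update w a (I.marginal a S), ?_, fun A hA => ?_, fun i hi => ?_⟩
    · rw [Finset.sum_insert ha, key S ha, h1, Function.update_self, marginal]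
      ring
    · by_cases haA : a ∈ A
      · have hsub : A.erase a ⊆ S := by rwa [← Finset.subset_insert_iff]
        have h4 := I.marginal_anti hsub ha
        have h5 := h2 _ hsub
        rw [← Finset.add_sum_erase A _ haA, key _ (Finset.notMem_erase a A), Function.update_self]
        simp only [marginal, Finset.insert_erase haA] at h4 ⊢
        linarith
      · rw [key A haA]
        exact h2 A ((Finset.subset_insert_iff_of_notMem haA).1 hA)
    · rcases Finset.mem_insert.1 hi with rfl | hiS
      · rw [Function.update_self, Finset.erase_insert ha]
        exact ⟨le_rfl, I.marginal_le_singleton ha⟩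
      · have hne : i ≠ a := by rintro rfl; exact ha hiS
        rw [Function.update_of_ne hne]
        refine ⟨le_trans ?_ (h3 i hiS).1, (h3 i hiS).2⟩
        have h4 := I.marginal_anti (S := S.erase i) (T := insert a (S.erase i))
          (Finset.subset_insert _ _) (i := i) (by simp [hne])
        rw [marginal, marginal, Finset.insert_erase hiS, Finset.insert_comm,
          Finset.insert_erase hiS] at h4
        rwa [Finset.erase_insert_of_ne hne.symm]

theorem Feasible.mono {I : Instance n} {S T : Finset (Fin n)} (hT : I.Feasible T) (h : S ⊆ T) :
    I.Feasible S :=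
  (Finset.sum_le_sum_of_subset_of_nonneg h fun i _ _ => (I.c_pos i).le).trans hT

end Instance

/-! ### The posted-price loop for a fixed arrival order. -/

namespace Mechanism

variable {n : ℕ} {I : Instance n}

/-- What holds along the posted-price loop with threshold `t` once the agents in `D` have
arrived. -/
structure LoopInvariant (I : Instance n) (t : ℝ) (D : Finset (Fin n)) (s : LoopState n) : Prop where
  sol_subset : ∀ j, s.sol j ⊆ D
  disjoint : ∀ j l, j ≠ l → Disjoint (s.sol j) (s.sol l)
  bud_eq : ∀ j, s.bud j = I.B - I.B / t * I.v (s.sol j)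
  -- Each agent preferred the solution she joined, so her marginal to the other one was no larger,
  -- and it only decreases afterwards. The marginals to her own solution telescope to its value.
  sum_le : ∀ j l, j ≠ l → ∀ O : Finset (Fin n),
    ∑ i ∈ s.sol j ∩ O, I.marginal i (s.sol l) ≤ I.v (s.sol j)
  -- As long as no agent has been refused for lack of budget, every refusal was caused by the
  -- agent's cost exceeding the price.
  exhausted_or_marginal_le : (∃ i j, t - I.v {i} < I.v (s.sol j)) ∨
    ∀ i ∈ D, (∀ j, i ∉ s.sol j) → ∀ l, I.marginal i (s.sol l) ≤ t * I.c i / I.B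

theorem LoopInvariant.init (I : Instance n) (t : ℝ) :
    LoopInvariant I t ∅ { sol := fun _ => ∅, bud := fun _ => I.B, price := fun _ => 0 } where
  sol_subset := by simp
  disjoint := by simp
  bud_eq := by simp [I.v_empty]
  sum_le := by simp [I.v_empty]
  exhausted_or_marginal_le := Or.inr (by simp)

theorem LoopInvariant.step {C : Choices I} {t : ℝ} (ht : 0 < t) {D : Finset (Fin n)}
    {s : LoopState n} (h : LoopInvariant I t D s) {i : Fin n} (hi : i ∉ D) :
    LoopInvariant I t (insert i D) (step C t s i) := by
  have hnot : ∀ l, i ∉ s.sol l := fun l hl => hi (h.sol_subset l hl)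
  have hB := I.B_pos
  have hpick := C.pick_spec s.sol i
  unfold Mechanism.step
  set j := C.pick s.sol i with hj
  simp only []
  split_ifs with hc
  · obtain ⟨hc1, hc2⟩ := hc
    -- An accepted price covers a positive cost, so accepted marginals are positive: the values of
    -- the solutions never decrease, although `v` may be non-monotone.
    have hpos : 0 < I.marginal i (s.sol j) := by
      have := (I.c_pos i).trans_le hc1
      exact pos_of_mul_pos_right this (by positivity)
    have hv : I.v (insert i (s.sol j)) = I.v (s.sol j) + I.marginal i (s.sol j) := by
      rw [Instance.marginal]; ring
    have hgrow : ∀ l, s.sol l ⊆ Function.update s.sol j (insert i (s.sol j)) l := by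
      intro l
      rcases eq_or_ne l j with rfl | hl
      · simp
      · simp [hl]
    refine ⟨?_, ?_, ?_, ?_, ?_⟩
    · intro l
      rcases eq_or_ne l j with rfl | hl
      · simpa using Finset.insert_subset_insert i (h.sol_subset _)
      · simpa [hl] using (h.sol_subset l).trans (Finset.subset_insert i D)
    · intro l m hlm
      rcases eq_or_ne l j with rfl | hl
      · simpa [hlm.symm, hnot] using h.disjoint _ _ hlm
      · rcases eq_or_ne m j with rfl | hm
        · simpa [hlm, hnot] using h.disjoint _ _ hlm
        · simpa [hl, hm] using h.disjoint _ _ hlm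
    · intro l
      rcases eq_or_ne l j with rfl | hl
      · simp only [Function.update_self, hv, h.bud_eq]; ring
      · simpa [hl] using h.bud_eq l
    · intro l m hlm O
      rcases eq_or_ne l j with rfl | hl
      · have h1 := h.sum_le _ m hlm O
        simp only [Function.update_self, Function.update_of_ne hlm.symm, hv]
        by_cases hO : i ∈ O
        · rw [Finset.insert_inter_of_mem hO, Finset.sum_insert (by simp [hnot])]
          linarith [hpick m]
        · rw [Finset.insert_inter_of_notMem hO]
          linarith
      · simp only [Function.update_of_ne hl]
        refine le_trans (Finset.sum_le_sum fun x hx => ?_) (h.sum_le l m hlm O)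
        have hxl := (Finset.mem_inter.1 hx).1
        apply I.marginal_anti (hgrow m)
        have hxm : x ∉ s.sol m := Finset.disjoint_left.1 (h.disjoint l m hlm) hxl
        rcases eq_or_ne m j with rfl | hm
        · have : x ≠ i := by rintro rfl; exact hnot _ hxl
          simp [this, hxm]
        · simpa [hm] using hxm
    · rcases h.exhausted_or_marginal_le with ⟨x, l, hx⟩ | h1
      · refine Or.inl ⟨x, l, hx.trans_le ?_⟩
        rcases eq_or_ne l j with rfl | hl
        · simp only [Function.update_self, hv]; linarith
        · simp [hl]
      · refine Or.inr fun x hx hxs l => ?_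
        have hxi : x ≠ i := by
          rintro rfl
          exact hxs j (by simp)
        have hxD := Finset.mem_of_mem_insert_of_ne hx hxi
        exact (I.marginal_anti (hgrow l) (hxs l)).trans
          (h1 x hxD (fun m hm => hxs m (hgrow m hm)) l)
  · refine ⟨fun l => (h.sol_subset l).trans (Finset.subset_insert i D), h.disjoint, h.bud_eq,
      h.sum_le, ?_⟩
    rcases h.exhausted_or_marginal_le with h1 | h1
    · exact Or.inl h1
    by_cases hci : I.c i ≤ I.B / t * I.marginal i (s.sol j)
    -- The spent budget is `(B/t) v(S_j)`, so an unaffordable price means `v(S_j) + v(i | S_j) > t`,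
    -- and the marginal is at most `v(i)`.
    · refine Or.inl ⟨i, j, ?_⟩
      have h2 : s.bud j - I.B / t * I.marginal i (s.sol j) < 0 := by
        by_contra h3
        exact hc ⟨hci, not_lt.1 h3⟩
      rw [h.bud_eq] at h2
      have h3 := I.marginal_le_singleton (hnot j)
      have h4 : I.B < I.B / t * (I.v (s.sol j) + I.marginal i (s.sol j)) := by linarith
      rw [div_mul_eq_mul_div, lt_div_iff₀ ht] at h4
      have h5 := lt_of_mul_lt_mul_left h4 hB.le
      linarith
    · refine Or.inr fun x hx hxs l => ?_
      rcases Finset.mem_insert.1 hx with rfl | hxD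
      · rw [not_le, div_mul_eq_mul_div, div_lt_iff₀ ht] at hci
        rw [le_div_iff₀ hB]
        nlinarith [hpick l]
      · exact h1 x hxD hxs l

theorem LoopInvariant.foldl {C : Choices I} {t : ℝ} (ht : 0 < t) (l : List (Fin n)) :
    ∀ {D : Finset (Fin n)} {s : LoopState n}, LoopInvariant I t D s → l.Nodup →
      (∀ i ∈ l, i ∉ D) → LoopInvariant I t (D ∪ l.toFinset) (l.foldl (Mechanism.step C t) s) := by
  induction l with
  | nil => intro D s h _ _; simpa using h
  | cons i l ih =>
    intro D s h hl hD
    rw [List.nodup_cons] at hl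
    have := ih (h.step (C := C) ht (hD i (by simp))) hl.2 fun x hx => by
      rw [Finset.mem_insert, not_or]
      exact ⟨by rintro rfl; exact hl.1 hx, hD x (by simp [hx])⟩
    simpa [Finset.insert_union] using this

/-- The two solutions of the loop are worth enough, unless one of them exhausted its budget. -/
theorem LoopInvariant.value_ge {t : ℝ} (ht : 0 < t) {D O : Finset (Fin n)} {s : LoopState n}
    (h : LoopInvariant I t D s) (hO : I.Feasible O) (hOD : O ⊆ D) :
    (∃ i j, t - I.v {i} < I.v (s.sol j)) ∨
      1 / 2 * I.v O - t ≤ I.v (s.sol 0) + I.v (s.sol 1) := by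
  rcases h.exhausted_or_marginal_le with h1 | h1
  · exact Or.inl h1
  refine Or.inr ?_
  have key : ∀ j l : Fin 2, j ≠ l → (∀ m, m = j ∨ m = l) →
      I.v (s.sol l ∪ O) - I.v (s.sol l) ≤ I.v (s.sol j) + t := by
    intro j l hjl hall
    have h2 := I.v_union_sub_le_sum_marginal (s.sol l) (O \ s.sol l) Finset.disjoint_sdiff
    rw [Finset.union_sdiff_self_eq_union] at h2
    refine h2.trans ?_
    -- Agents held by the other solution are charged to its value by `sum_le`; refused agents cost
    -- at most `B` together, so their marginals add up to at most `t`.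
    have hsplit : O \ s.sol l = (s.sol j ∩ O) ∪ (O \ (s.sol j ∪ s.sol l)) := by
      ext x
      have : x ∈ s.sol j → x ∉ s.sol l := fun hx => Finset.disjoint_left.1 (h.disjoint j l hjl) hx
      simp only [Finset.mem_sdiff, Finset.mem_union, Finset.mem_inter]
      tauto
    have hdisj : Disjoint (s.sol j ∩ O) (O \ (s.sol j ∪ s.sol l)) := by
      rw [Finset.disjoint_left]
      intro x hx
      simp only [Finset.mem_sdiff, Finset.mem_union, Finset.mem_inter] at hx ⊢
      tauto
    rw [hsplit, Finset.sum_union hdisj]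
    refine add_le_add (h.sum_le j l hjl O) ?_
    calc ∑ i ∈ O \ (s.sol j ∪ s.sol l), I.marginal i (s.sol l)
        ≤ ∑ i ∈ O \ (s.sol j ∪ s.sol l), t / I.B * I.c i := by
          refine Finset.sum_le_sum fun x hx => ?_
          simp only [Finset.mem_sdiff, Finset.mem_union, not_or] at hx
          rw [div_mul_eq_mul_div]
          refine h1 x (hOD hx.1) (fun m => ?_) l
          rcases hall m with rfl | rfl
          exacts [hx.2.1, hx.2.2]
      _ = t / I.B * ∑ i ∈ O \ (s.sol j ∪ s.sol l), I.c i := by rw [Finset.mul_sum]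
      _ ≤ t / I.B * I.B := by
          have hB := I.B_pos
          gcongr
          exact hO.mono Finset.sdiff_subset
      _ = t := div_mul_cancel₀ _ I.B_pos.ne'
  have h2 := key 0 1 (by decide) (by decide)
  have h3 := key 1 0 (by decide) (by decide)
  have h4 := I.v_le_union_add_union O (h.disjoint 0 1 (by decide))
  linarith

theorem nodup_arrivals (σ : Equiv.Perm (Fin n)) : (arrivals σ).Nodup :=
  List.nodup_ofFn.2 σ.injective

theorem toFinset_drop_arrivals (σ : Equiv.Perm (Fin n)) (ξ : ℕ) :
    ((arrivals σ).drop ξ).toFinset = ((arrivals σ).take ξ).toFinsetᶜ := by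
  ext x
  have h1 : x ∈ (arrivals σ).take ξ ++ (arrivals σ).drop ξ := by
    rw [List.take_append_drop, arrivals, List.mem_ofFn]
    exact σ.surjective x
  have h2 := nodup_arrivals σ
  rw [← List.take_append_drop ξ (arrivals σ), List.nodup_append'] at h2
  have h3 : x ∈ (arrivals σ).take ξ → x ∉ (arrivals σ).drop ξ := fun h => h2.2.2 h
  rw [List.mem_append] at h1
  simp only [List.mem_toFinset, Finset.mem_compl]
  tauto

/-- The posted-price branch returns on average the smaller of the two guarantees. -/
theorem posted_value_ge (P : Params) (C : Choices I) (ω : ℝ) (σ : Equiv.Perm (Fin n)) (ξ : ℕ)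
    {O : Finset (Fin n)} (hO : I.Feasible O) {V : ℝ} (hV : ∀ i, I.v {i} ≤ V)
    (ht : 0 < threshold P C ω σ ξ) :
    min (1 / 4 * I.v (O ∩ ((arrivals σ).take ξ).toFinsetᶜ) - 1 / 2 * threshold P C ω σ ξ)
        (1 / 2 * (threshold P C ω σ ξ - V)) ≤
      ∑ j : Fin 2, (1 / 2 : ℝ) * I.v (posted P C ω σ ξ j).winners := by
  have hinv := (LoopInvariant.init I (threshold P C ω σ ξ)).foldl (C := C) ht
    ((arrivals σ).drop ξ) ((List.drop_sublist _ _).nodup (nodup_arrivals σ)) (by simp)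
  rw [Finset.empty_union, toFinset_drop_arrivals] at hinv
  have h := hinv.value_ge ht (hO.mono Finset.inter_subset_left)
    (Finset.inter_subset_right (s₁ := O))
  simp only [posted, Fin.sum_univ_two]
  set s := ((arrivals σ).drop ξ).foldl (step C (threshold P C ω σ ξ))
    { sol := fun _ => ∅, bud := fun _ => I.B, price := fun _ => 0 }
  have h0 := I.v_nonneg (s.sol 0)
  have h1 := I.v_nonneg (s.sol 1)
  rcases h with ⟨i, j, hij⟩ | h
  · refine (min_le_right _ _).trans ?_
    have := hV i
    rcases j with ⟨j, hj⟩
    interval_cases j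
    · change _ < I.v (s.sol 0) at hij
      linarith
    · change _ < I.v (s.sol 1) at hij
      linarith
  · exact (min_le_left _ _).trans (by linarith)

end Mechanism

/-! ### Bernstein's inequality for random subsets. -/

/-- This is `e^x ≤ 1 + x + x²/(2(1 - x/3))` with the denominator cleared, which keeps it valid for
all `x ≥ 0`. After multiplication by `e^{-x}` the difference of the sides vanishes at `0`, and its
derivative has the sign of `e^x - (1 + x + x²/2)`. -/
theorem Real.exp_mul_one_sub_third_le {x : ℝ} (hx : 0 ≤ x) :
    Real.exp x * (1 - x / 3) ≤ 1 + 2 * x / 3 + x ^ 2 / 6 := by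
  have hd : ∀ y : ℝ, HasDerivAt
      (fun y : ℝ => Real.exp (-y) * (1 + 2 * y / 3 + y ^ 2 / 6) - (1 - y / 3))
      (1 / 3 * (1 - Real.exp (-y) * (1 + y + y ^ 2 / 2))) y := by
    intro y
    have h1 : HasDerivAt (fun y : ℝ => Real.exp (-y)) (Real.exp (-y) * (-1)) y :=
      (hasDerivAt_neg y).exp
    have h2 : HasDerivAt (fun y : ℝ => 1 + 2 * y / 3 + y ^ 2 / 6)
        (2 * 1 / 3 + (2 : ℕ) * y ^ (2 - 1) / 6) y :=
      ((((hasDerivAt_id' y).const_mul 2).div_const 3).const_add 1).add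
        ((hasDerivAt_pow 2 y).div_const 6)
    have h3 := (h1.mul h2).sub (((hasDerivAt_id' y).div_const 3).const_sub 1)
    refine h3.congr_deriv ?_
    norm_num
    ring
  have hmono := monotoneOn_of_deriv_nonneg (convex_Ici (0 : ℝ))
    (fun y _ => (hd y).continuousAt.continuousWithinAt)
    (fun y _ => (hd y).differentiableAt.differentiableWithinAt) (fun y hy => by
      rw [(hd y).deriv]
      rw [interior_Ici, Set.mem_Ioi] at hy
      have h1 := Real.quadratic_le_exp_of_nonneg hy.le
      have h2 : Real.exp (-y) * (1 + y + y ^ 2 / 2) ≤ Real.exp (-y) * Real.exp y := by gcongr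
      rw [← Real.exp_add, neg_add_cancel, Real.exp_zero] at h2
      linarith)
  have h := hmono (Set.mem_Ici.2 le_rfl) (Set.mem_Ici.2 hx) hx
  norm_num at h
  have h2 : Real.exp x * (1 - x / 3) ≤
      Real.exp x * (Real.exp (-x) * (1 + 2 * x / 3 + x ^ 2 / 6)) := by
    gcongr
    linarith
  rwa [← mul_assoc, ← Real.exp_add, add_neg_cancel, Real.exp_zero, one_mul] at h2

theorem Real.exp_le_of_le_of_lt_three {x b : ℝ} (hb : 0 ≤ b) (hb3 : b < 3) (hx : x ≤ b) :
    Real.exp x ≤ 1 + x + x ^ 2 / (2 * (1 - b / 3)) := by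
  have hpos : 0 < 1 - b / 3 := by linarith
  rcases le_total 0 x with h0 | h0
  · have hposx : 0 < 1 - x / 3 := by linarith
    have h1 := Real.exp_mul_one_sub_third_le h0
    have h2 : Real.exp x ≤ 1 + x + x ^ 2 / (2 * (1 - x / 3)) := by
      rw [← le_div_iff₀ hposx] at h1
      refine h1.trans_eq ?_
      have : 3 - x ≠ 0 := by linarith
      have h3 : 1 - x / 3 = (3 - x) / 3 := by ring
      rw [h3]
      field_simp
      ring
    refine h2.trans ?_
    gcongr
  · have h1 : Real.exp x ≤ 1 + x + x ^ 2 / 2 := by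
      have h2 := Real.quadratic_le_exp_of_nonneg (neg_nonneg.2 h0)
      have h3 : Real.exp x * (1 + -x + (-x) ^ 2 / 2) ≤ Real.exp x * Real.exp (-x) := by gcongr
      rw [← Real.exp_add, add_neg_cancel, Real.exp_zero] at h3
      have h4 : 0 < 1 + -x + (-x) ^ 2 / 2 := by nlinarith
      rw [← le_div_iff₀ h4] at h3
      refine h3.trans ?_
      rw [div_le_iff₀ h4]
      -- `(1 + x + x²/2)(1 - x + x²/2) = 1 + x⁴/4 ≥ 1`.
      nlinarith [sq_nonneg (x ^ 2)]
    refine h1.trans ?_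
    gcongr
    linarith

/-- The moment generating function of a centred, negated and scaled Bernoulli variable. -/
theorem Real.bernoulli_mgf_le {p x b : ℝ} (hp0 : 0 ≤ p) (hp1 : p ≤ 1) (hx : 0 ≤ x) (hxb : x ≤ b)
    (hb3 : b < 3) :
    p * Real.exp (-((1 - p) * x)) + (1 - p) * Real.exp (p * x) ≤
      Real.exp (p * (1 - p) * x ^ 2 / (2 * (1 - b / 3))) := by
  have hb := hx.trans hxb
  have hq : 0 ≤ 1 - p := by linarith
  have h1 := Real.exp_le_of_le_of_lt_three hb hb3 (x := -((1 - p) * x)) (by nlinarith)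
  have h2 := Real.exp_le_of_le_of_lt_three hb hb3 (x := p * x) (by nlinarith)
  have h3 := Real.add_one_le_exp (p * (1 - p) * x ^ 2 / (2 * (1 - b / 3)))
  refine le_trans ?_ h3
  calc _ ≤ p * (1 + -((1 - p) * x) + (-((1 - p) * x)) ^ 2 / (2 * (1 - b / 3))) +
        (1 - p) * (1 + p * x + (p * x) ^ 2 / (2 * (1 - b / 3))) := by gcongr
    _ = _ := by ring

/-- The probability that a random subset, which contains each element independently with
probability `p`, is equal to `A`. -/
noncomputable def bernoulliWeight {n : ℕ} (p : ℝ) (A : Finset (Fin n)) : ℝ :=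
  p ^ A.card * (1 - p) ^ (n - A.card)

section Bernoulli

variable {n : ℕ} {p : ℝ}

theorem bernoulliWeight_nonneg (hp0 : 0 ≤ p) (hp1 : p ≤ 1) (A : Finset (Fin n)) :
    0 ≤ bernoulliWeight p A :=
  mul_nonneg (pow_nonneg hp0 _) (pow_nonneg (by linarith) _)

theorem bernoulliWeight_compl (A : Finset (Fin n)) :
    bernoulliWeight p Aᶜ = bernoulliWeight (1 - p) A := by
  have h : A.card ≤ n := by simpa using A.card_le_univ
  rw [bernoulliWeight, bernoulliWeight, Finset.card_compl, Fintype.card_fin,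
    Nat.sub_sub_self h, sub_sub_cancel, mul_comm]

theorem sum_bernoulliWeight_mul_prod (x y : Fin n → ℝ) :
    ∑ A : Finset (Fin n), bernoulliWeight p A * ((∏ i ∈ A, x i) * ∏ i ∈ Aᶜ, y i) =
      ∏ i, (p * x i + (1 - p) * y i) := by
  rw [Finset.prod_add, Finset.powerset_univ]
  refine Finset.sum_congr rfl fun A _ => ?_
  rw [Finset.prod_mul_distrib, Finset.prod_mul_distrib, Finset.prod_const, Finset.prod_const,
    ← Finset.compl_eq_univ_sdiff, Finset.card_compl, Fintype.card_fin, bernoulliWeight]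
  ring

theorem sum_bernoulliWeight : ∑ A : Finset (Fin n), bernoulliWeight p A = 1 := by
  simpa using sum_bernoulliWeight_mul_prod (p := p) (fun _ : Fin n => 1) fun _ => 1

open Classical in
/-- Bernstein's inequality for the lower tail of a weighted sum over a random subset. -/
theorem bernoulli_lower_tail (hp0 : 0 < p) (hp1 : p < 1) {w : Fin n → ℝ} {M W δ : ℝ}
    (hw0 : ∀ i, 0 ≤ w i) (hwM : ∀ i, w i ≤ M) (hW : ∑ i, w i = W) (hM : 0 < M) (hWpos : 0 < W)
    (hδ : 0 < δ) :
    ∑ A : Finset (Fin n), (if ∑ i ∈ A, w i < (p - δ) * W then bernoulliWeight p A else 0) ≤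
      Real.exp (-((δ * W) ^ 2 / (2 * (p * (1 - p) * M * W + M * (δ * W) / 3)))) := by
  have hq : 0 < 1 - p := by linarith
  -- `V` bounds the variance `p(1-p) ∑ wᵢ²`, because `wᵢ² ≤ M wᵢ`.
  set V := p * (1 - p) * M * W with hV
  have hVpos : 0 < V := by positivity
  set t := δ * W with ht
  have htpos : 0 < t := by positivity
  have hden : 0 < V + M * t / 3 := by positivity
  -- Bernstein's choice of the exponential parameter: `1 - sM/3 = V/(V + Mt/3)`, so the final
  -- exponent `-st + s²V/(2(1 - sM/3))` collapses to `-t²/(2(V + Mt/3))`.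
  set s := t / (V + M * t / 3) with hs
  have hspos : 0 < s := by positivity
  have hsM : 1 - s * M / 3 = V / (V + M * t / 3) := by
    rw [hs]; field_simp; ring
  have hsM3 : s * M < 3 := by
    have : 0 < 1 - s * M / 3 := by rw [hsM]; positivity
    linarith
  have hpos : 0 < 1 - s * M / 3 := by linarith
  have hprod : ∑ A : Finset (Fin n), bernoulliWeight p A *
      ((∏ i ∈ A, Real.exp (-((1 - p) * (s * w i)))) * ∏ i ∈ Aᶜ, Real.exp (p * (s * w i))) ≤
      Real.exp (s ^ 2 * (V + M * t / 3) / 2) := by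
    rw [sum_bernoulliWeight_mul_prod]
    calc _ ≤ ∏ i, Real.exp (p * (1 - p) * (s * w i) ^ 2 / (2 * (1 - s * M / 3))) := by
          refine Finset.prod_le_prod (fun i _ => by positivity) fun i _ => ?_
          refine Real.bernoulli_mgf_le hp0.le hp1.le (mul_nonneg hspos.le (hw0 i)) ?_ hsM3
          exact mul_le_mul_of_nonneg_left (hwM i) hspos.le
      _ = Real.exp (∑ i, p * (1 - p) * (s * w i) ^ 2 / (2 * (1 - s * M / 3))) :=
          (Real.exp_sum _ _).symm
      _ ≤ _ := by
          apply Real.exp_le_exp.2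
          calc _ ≤ ∑ i, p * (1 - p) * s ^ 2 * M / (2 * (1 - s * M / 3)) * w i := by
                refine Finset.sum_le_sum fun i _ => ?_
                rw [div_mul_eq_mul_div (p * (1 - p) * s ^ 2 * M)]
                apply div_le_div_of_nonneg_right ?_ (by positivity : (0 : ℝ) ≤ 2 * (1 - s * M / 3))
                have : w i ^ 2 ≤ M * w i := by nlinarith [hw0 i, hwM i]
                calc p * (1 - p) * (s * w i) ^ 2 = p * (1 - p) * s ^ 2 * w i ^ 2 := by ring
                  _ ≤ p * (1 - p) * s ^ 2 * (M * w i) := by gcongr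
                  _ = _ := by ring
            _ = p * (1 - p) * s ^ 2 * M / (2 * (1 - s * M / 3)) * W := by
                rw [← Finset.mul_sum, hW]
            _ = s ^ 2 * V / (2 * (1 - s * M / 3)) := by rw [hV]; ring
            _ = _ := by rw [hsM]; field_simp
  calc _ ≤ ∑ A : Finset (Fin n), Real.exp (-(s * t)) * (bernoulliWeight p A *
        ((∏ i ∈ A, Real.exp (-((1 - p) * (s * w i)))) *
          ∏ i ∈ Aᶜ, Real.exp (p * (s * w i)))) := by
        refine Finset.sum_le_sum fun A _ => ?_
        have hb := bernoulliWeight_nonneg hp0.le hp1.le A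
        split_ifs with hA
        · rw [mul_left_comm]
          -- Markov's inequality, set by set: the product of exponentials is `exp(s(pW - w(A)))`,
          -- which is at least `exp(st)` when `w(A) < (p - δ)W`.
          refine le_mul_of_one_le_right hb ?_
          rw [← Real.exp_sum, ← Real.exp_sum, ← Real.exp_add, ← Real.exp_add]
          apply Real.one_le_exp
          have h1 := Finset.sum_add_sum_compl A w
          have e1 : ∑ i ∈ A, -((1 - p) * (s * w i)) = -((1 - p) * s) * ∑ i ∈ A, w i := by
            rw [Finset.mul_sum]; exact Finset.sum_congr rfl fun i _ => by ring
          have e2 : ∑ i ∈ Aᶜ, p * (s * w i) = p * s * ∑ i ∈ Aᶜ, w i := by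
            rw [Finset.mul_sum]; exact Finset.sum_congr rfl fun i _ => by ring
          have e3 : ∑ i ∈ Aᶜ, w i = W - ∑ i ∈ A, w i := by rw [← hW]; linarith
          rw [e1, e2, e3]
          have : 0 ≤ s * ((p - δ) * W - ∑ i ∈ A, w i) :=
            mul_nonneg hspos.le (by linarith)
          rw [ht]
          linarith
        · positivity
    _ ≤ Real.exp (-(s * t)) * Real.exp (s ^ 2 * (V + M * t / 3) / 2) := by
        rw [← Finset.mul_sum]
        gcongr
    _ = _ := by
        rw [← Real.exp_add]
        congr 1
        rw [hs]
        field_simp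
        ring

open Classical in
/-- With high probability a random subset and its complement both carry about their share of the
total weight. -/
theorem bernoulli_two_sided (hp0 : 0 < p) (hp1 : p < 1) {w : Fin n → ℝ} {M W δ : ℝ}
    (hw0 : ∀ i, 0 ≤ w i) (hwM : ∀ i, w i ≤ M) (hW : ∑ i, w i = W) (hM : 0 < M) (hWpos : 0 < W)
    (hδ : 0 < δ) :
    1 - 2 * Real.exp (-((δ * W) ^ 2 / (2 * (p * (1 - p) * M * W + M * (δ * W) / 3)))) ≤
      ∑ A : Finset (Fin n), (if (p - δ) * W ≤ ∑ i ∈ A, w i ∧ (1 - p - δ) * W ≤ ∑ i ∈ Aᶜ, w i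
        then bernoulliWeight p A else 0) := by
  have h1 := bernoulli_lower_tail hp0 hp1 hw0 hwM hW hM hWpos hδ
  -- The complement is a random subset with parameter `1 - p`, and the bound is symmetric in `p` and
  -- `1 - p`; a union bound over the two tails follows.
  have h2 := bernoulli_lower_tail (p := 1 - p) (by linarith) (by linarith) hw0 hwM hW hM hWpos hδ
  rw [sub_sub_cancel, mul_comm (1 - p) p] at h2
  have h3 : ∑ A : Finset (Fin n),
      (if ∑ i ∈ A, w i < (1 - p - δ) * W then bernoulliWeight (1 - p) A else 0) =
      ∑ A : Finset (Fin n),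
        (if ∑ i ∈ Aᶜ, w i < (1 - p - δ) * W then bernoulliWeight p A else 0) := by
    refine Fintype.sum_equiv (Equiv.mk compl compl compl_compl compl_compl) _ _ fun A => ?_
    simp only [Equiv.coe_fn_mk, compl_compl, bernoulliWeight_compl]
  rw [h3] at h2
  have h4 : ∑ A : Finset (Fin n), bernoulliWeight p A ≤
      ∑ A : Finset (Fin n), ((if (p - δ) * W ≤ ∑ i ∈ A, w i ∧ (1 - p - δ) * W ≤ ∑ i ∈ Aᶜ, w i
        then bernoulliWeight p A else 0) +
      (if ∑ i ∈ A, w i < (p - δ) * W then bernoulliWeight p A else 0) +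
      (if ∑ i ∈ Aᶜ, w i < (1 - p - δ) * W then bernoulliWeight p A else 0)) := by
    refine Finset.sum_le_sum fun A _ => ?_
    have hb := bernoulliWeight_nonneg hp0.le hp1.le A
    split_ifs with h5 h6 h7 h7 h6 h7 h7
    any_goals linarith
    exact absurd ⟨not_lt.1 h6, not_lt.1 h7⟩ h5
  rw [sum_bernoulliWeight, Finset.sum_add_distrib, Finset.sum_add_distrib] at h4
  linarith

end Bernoulli

/-! ### The sample as an independent random subset. -/

section RandomOrder

variable {n : ℕ}

theorem exists_perm_map_eq {A A' : Finset (Fin n)} (h : A.card = A'.card) :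
    ∃ τ : Equiv.Perm (Fin n), A.map τ.toEmbedding = A' := by
  have e : {x // x ∈ A} ≃ {x // x ∈ A'} := Fintype.equivOfCardEq (by simpa using h)
  refine ⟨e.extendSubtype, ?_⟩
  refine Finset.eq_of_subset_of_card_le (fun x hx => ?_) (by simp [h])
  obtain ⟨y, hy, rfl⟩ := Finset.mem_map.1 hx
  exact e.extendSubtype_mem y hy

/-- The image of a fixed set under a uniformly random permutation is a uniformly random set. -/
theorem sum_perm_map (A : Finset (Fin n)) (f : Finset (Fin n) → ℝ) :
    (n.choose A.card : ℝ) * ∑ σ : Equiv.Perm (Fin n), f (A.map σ.toEmbedding) =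
      n.factorial * ∑ S ∈ Finset.powersetCard A.card Finset.univ, f S := by
  have h1 : ∀ A' ∈ Finset.powersetCard A.card (Finset.univ : Finset (Fin n)),
      ∑ σ : Equiv.Perm (Fin n), f (A'.map σ.toEmbedding) =
        ∑ σ : Equiv.Perm (Fin n), f (A.map σ.toEmbedding) := by
    intro A' hA'
    obtain ⟨τ, rfl⟩ := exists_perm_map_eq (Finset.mem_powersetCard.1 hA').2.symm
    refine Fintype.sum_equiv (Equiv.mulRight τ) _ _ fun σ => ?_
    rw [Finset.map_map]
    rfl
  have h2 : ∀ σ : Equiv.Perm (Fin n),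
      ∑ A' ∈ Finset.powersetCard A.card (Finset.univ : Finset (Fin n)), f (A'.map σ.toEmbedding) =
        ∑ S ∈ Finset.powersetCard A.card Finset.univ, f S := by
    intro σ
    refine Finset.sum_bij' (fun S _ => S.map σ.toEmbedding) (fun S _ => S.map σ.symm.toEmbedding)
      ?_ ?_ ?_ ?_ ?_
    · intro S hS
      simpa [Finset.mem_powersetCard] using hS
    · intro S hS
      simpa [Finset.mem_powersetCard] using hS
    · intro S _
      ext; simp
    · intro S _
      ext; simp
    · simp
  -- Double counting over pairs of a set of the given size and a permutation: by `h1` the sum over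
  -- `σ` is the same for every set, by `h2` the sum over sets is the same for every `σ`.
  have h3 := Finset.sum_congr rfl h1
  rw [Finset.sum_comm, Finset.sum_congr rfl fun σ _ => h2 σ] at h3
  simp only [Finset.sum_const, Finset.card_powersetCard, Finset.card_univ, Fintype.card_fin,
    Fintype.card_perm, nsmul_eq_mul] at h3
  exact h3.symm

theorem Mechanism.toFinset_take_arrivals (σ : Equiv.Perm (Fin n)) (ξ : ℕ) :
    ((Mechanism.arrivals σ).take ξ).toFinset =
      (Finset.univ.filter fun i : Fin n => (i : ℕ) < ξ).map σ.toEmbedding := by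
  ext x
  simp only [List.mem_toFinset, Mechanism.arrivals, List.mem_take_iff_getElem, Finset.mem_map,
    Finset.mem_filter, Finset.mem_univ, true_and, List.getElem_ofFn, List.length_ofFn]
  constructor
  · rintro ⟨i, hi, rfl⟩
    exact ⟨⟨i, by omega⟩, by simp; omega, rfl⟩
  · rintro ⟨i, hi, rfl⟩
    exact ⟨i, by omega, rfl⟩

/-- The set of the first `ξ` agents of a uniformly random order, for binomial `ξ`, contains each
agent independently with probability `1/k`. -/
theorem Mechanism.sum_binomialWeight_take (k : ℝ) (f : Finset (Fin n) → ℝ) :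
    ∑ σ : Equiv.Perm (Fin n), 1 / (n.factorial : ℝ) *
      ∑ ξ ∈ Finset.range (n + 1), Mechanism.binomialWeight n k ξ *
        f ((Mechanism.arrivals σ).take ξ).toFinset =
      ∑ A : Finset (Fin n), bernoulliWeight (1 / k) A * f A := by
  rw [← Finset.mul_sum, Finset.sum_comm, ← Finset.powerset_univ, Finset.sum_powerset,
    Finset.card_univ, Fintype.card_fin, Finset.mul_sum]
  refine Finset.sum_congr rfl fun ξ hξ => ?_
  have hξn : ξ ≤ n := Nat.lt_succ_iff.1 (Finset.mem_range.1 hξ)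
  have hcard : (Finset.univ.filter fun i : Fin n => (i : ℕ) < ξ).card = ξ := by
    rw [Fin.card_filter_val_lt, min_eq_right hξn]
  have h := sum_perm_map (Finset.univ.filter fun i : Fin n => (i : ℕ) < ξ) f
  rw [hcard] at h
  have hfac : (n.factorial : ℝ) ≠ 0 := by positivity
  simp only [toFinset_take_arrivals, binomialWeight]
  rw [← Finset.mul_sum]
  have h2 : ∑ S ∈ Finset.powersetCard ξ Finset.univ, bernoulliWeight (1 / k) S * f S =
      (1 / k) ^ ξ * (1 - 1 / k) ^ (n - ξ) * ∑ S ∈ Finset.powersetCard ξ Finset.univ, f S := by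
    rw [Finset.mul_sum]
    refine Finset.sum_congr rfl fun S hS => ?_
    rw [bernoulliWeight, (Finset.mem_powersetCard.1 hS).2]
  rw [h2]
  calc _ = 1 / (n.factorial : ℝ) * ((1 / k) ^ ξ * (1 - 1 / k) ^ (n - ξ)) *
        ((n.choose ξ : ℝ) * ∑ σ : Equiv.Perm (Fin n),
          f ((Finset.univ.filter fun i : Fin n => (i : ℕ) < ξ).map σ.toEmbedding)) := by ring
    _ = _ := by rw [h]; field_simp

end RandomOrder

/-! ### The success probability of Dynkin's algorithm. -/

/-- The right side is `sinh (log x)`. At `x = (m+1)/m` it equals the trapezoid `(1/m + 1/(m+1))/2`.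
-/
theorem Real.log_le_half_sub_inv {x : ℝ} (hx : 1 ≤ x) : Real.log x ≤ (x - x⁻¹) / 2 := by
  rw [← Real.sinh_log (by linarith)]
  exact Real.self_le_sinh_iff.2 (Real.log_nonneg hx)

/-- A lower bound on harmonic sums by the trapezoidal rule. -/
theorem log_add_le_sum_Ico_one_div {r n : ℕ} (hr : 0 < r) (hrn : r ≤ n) :
    Real.log (n / r) + (1 / r - 1 / n) / 2 ≤ ∑ m ∈ Finset.Ico r n, 1 / (m : ℝ) := by
  have hr' : (0 : ℝ) < r := by exact_mod_cast hr
  induction n, hrn using Nat.le_induction with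
  | base => simp [hr'.ne']
  | succ m hm ih =>
    have hm' : (0 : ℝ) < m := hr'.trans_le (by exact_mod_cast hm)
    rw [Finset.sum_Ico_succ_top hm]
    have h1 := Real.log_le_half_sub_inv (x := ((m : ℝ) + 1) / m)
      (by rw [le_div_iff₀ hm']; linarith)
    have h2 : Real.log (((m + 1 : ℕ) : ℝ) / r) = Real.log (m / r) + Real.log ((m + 1) / m) := by
      rw [← Real.log_mul (by positivity) (by positivity)]
      congr 1
      push_cast
      field_simp
    have h3 : (((m : ℝ) + 1) / m - (((m : ℝ) + 1) / m)⁻¹) / 2 = (1 / m + 1 / (m + 1)) / 2 := by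
      field_simp
      ring
    rw [h2]
    push_cast
    linarith

/-- With `y = n/(re)`, which lies in `[1, 1 + 1/r)`, the factor `r/n` is `1/(ey)`, so the harmonic
sum has to be at least `y`. The trapezoidal bound together with `log y ≥ 1 - 1/y` falls short of
this by `(y-1)²/y`, up to the correction `(1/r - 1/n)/2`, which makes up for it. -/
theorem floor_div_exp_mul_sum_ge {n r : ℕ} (hr : 0 < r) (h : r = ⌊(n : ℝ) / Real.exp 1⌋₊) :
    1 / Real.exp 1 ≤ r / n * ∑ m ∈ Finset.Ico r n, 1 / (m : ℝ) := by
  have he := Real.exp_pos 1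
  have he1 := Real.exp_one_gt_d9
  have he2 := Real.exp_one_lt_d9
  have hr' : (0 : ℝ) < r := by exact_mod_cast hr
  have h1 : (r : ℝ) ≤ n / Real.exp 1 := by
    rw [h]; exact Nat.floor_le (by positivity)
  have h2 : (n : ℝ) / Real.exp 1 < r + 1 := by
    rw [h]; exact Nat.lt_floor_add_one _
  rw [le_div_iff₀ he] at h1
  rw [div_lt_iff₀ he] at h2
  have hn' : (0 : ℝ) < n := by nlinarith
  -- The estimate for `r ≥ 2` uses `y ≤ 3/2`. For `r = 1` only `n = 3, 4, 5` occur, and these are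
  -- computed.
  rcases Nat.lt_or_ge r 2 with hr2 | hr2
  · obtain rfl : r = 1 := by omega
    have hn3 : 2 < n := by
      have : (2 : ℝ) < n := by push_cast at h1; linarith
      exact_mod_cast this
    have hn6 : n < 6 := by
      have : (n : ℝ) < 6 := by push_cast at h2; linarith
      exact_mod_cast this
    have h4 : 1 / Real.exp 1 ≤ 0.4 := by
      rw [div_le_iff₀ he]; linarith
    refine h4.trans ?_
    interval_cases n <;> norm_num [Finset.sum_Ico_succ_top]
  · have hr2' : (2 : ℝ) ≤ r := by exact_mod_cast hr2
    have hrn : r ≤ n := by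
      have : (r : ℝ) ≤ n := by nlinarith
      exact_mod_cast this
    have hsum := log_add_le_sum_Ico_one_div hr hrn
    set y : ℝ := n / (r * Real.exp 1) with hy
    have hy1 : 1 ≤ y := by rw [hy, le_div_iff₀ (by positivity)]; linarith
    have hy2 : r * (y - 1) < 1 := by
      have : r * y = n / Real.exp 1 := by rw [hy]; field_simp
      have h3 : (n : ℝ) / Real.exp 1 < r + 1 := by rwa [div_lt_iff₀ he]
      linarith
    have hny : (n : ℝ) = y * (r * Real.exp 1) := by rw [hy]; field_simp
    have hlog : Real.log (n / r) = Real.log y + 1 := by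
      have h3 : (n : ℝ) / r = y * Real.exp 1 := by rw [hy]; field_simp
      rw [h3, Real.log_mul (by positivity) he.ne', Real.log_exp]
    have hlog2 := Real.one_sub_inv_le_log_of_pos (x := y) (by positivity)
    have hmain : y ≤ ∑ m ∈ Finset.Ico r n, 1 / (m : ℝ) := by
      refine le_trans ?_ hsum
      rw [hlog]
      suffices hs : y ≤ 1 - y⁻¹ + 1 + (1 / r - 1 / n) / 2 by linarith
      have hypos : 0 < y := by linarith
      have hinv : 1 / Real.exp 1 ≤ 0.4 := by
        rw [div_le_iff₀ he]; linarith
      have h5 : (1 / (r : ℝ) - 1 / n) = (1 / r) * (y - 1 / Real.exp 1) / y := by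
        rw [hny]; field_simp
      have h6 : (y - 1) ^ 2 ≤ (1 / r) * (y - 1 / Real.exp 1) / 2 := by
        have h7 : y - 1 ≤ 1 / r := by rw [le_div_iff₀ hr']; linarith
        have h8 : (1 : ℝ) / r ≤ 1 / 2 := by gcongr
        have h9 : (y - 1) ^ 2 ≤ 1 / r * (y - 1) := by nlinarith
        have h10 : (1 : ℝ) / r * (y - 1) ≤ (1 / r) * ((y - 1 / Real.exp 1) / 2) := by
          gcongr
          linarith
        linarith
      rw [h5]
      have h11 : 1 - y⁻¹ + 1 + 1 / (r : ℝ) * (y - 1 / Real.exp 1) / y / 2 - y =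
          (1 / (r : ℝ) * (y - 1 / Real.exp 1) / 2 - (y - 1) ^ 2) / y := by
        field_simp
        ring
      have h12 : 0 ≤ (1 / (r : ℝ) * (y - 1 / Real.exp 1) / 2 - (y - 1) ^ 2) / y :=
        div_nonneg (by linarith) hypos.le
      linarith
    calc 1 / Real.exp 1 = r / n * y := by
          rw [hy]; field_simp
      _ ≤ _ := by gcongr

section Secretary

variable {n : ℕ}

theorem card_perm_apply_eq (m b : Fin n) :
    n * (Finset.univ.filter fun σ : Equiv.Perm (Fin n) => σ m = b).card = n.factorial := by
  have h : ∀ m' : Fin n, (Finset.univ.filter fun σ : Equiv.Perm (Fin n) => σ m' = b).card =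
      (Finset.univ.filter fun σ : Equiv.Perm (Fin n) => σ m = b).card := by
    intro m'
    refine Finset.card_equiv (Equiv.mulRight (Equiv.swap m m')) fun σ => ?_
    simp
  have h2 : ∑ m' : Fin n, (Finset.univ.filter fun σ : Equiv.Perm (Fin n) => σ m' = b).card =
      n.factorial := by
    simp_rw [Finset.card_filter]
    rw [Finset.sum_comm]
    have : ∀ σ : Equiv.Perm (Fin n), (∑ m' : Fin n, if σ m' = b then 1 else 0) = 1 := by
      intro σ
      simp_rw [← Equiv.eq_symm_apply]
      simp
    simp [this, Fintype.card_perm]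
  simpa [h] using h2

/-- The arrival orders in which `b` arrives at time `m`, and the highest ranked agent before her at
time `u`. -/
def recordOrders (rank : Fin n → ℕ) (b m u : Fin n) : Finset (Equiv.Perm (Fin n)) :=
  Finset.univ.filter fun σ => σ m = b ∧ ∀ x, x < m → rank (σ x) ≤ rank (σ u)

/-- Swapping two positions before `m` exchanges the corresponding sets of orders. Over the `m`
positions before time `m` (counted from `0`) these sets partition the orders with `σ m = b`, a
fraction `1/n` of all. -/
theorem card_recordOrders {rank : Fin n → ℕ} (hrank : Function.Injective rank) (b : Fin n)
    {m u : Fin n} (hu : u < m) :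
    n * ((m : ℕ) * (recordOrders rank b m u).card) = n.factorial := by
  have h : ∀ u' ∈ Finset.Iio m, (recordOrders rank b m u').card = (recordOrders rank b m u).card := by
    intro u' hu'
    rw [Finset.mem_Iio] at hu'
    refine Finset.card_equiv (Equiv.mulRight (Equiv.swap u u')) fun σ => ?_
    have hm : Equiv.swap u u' m = m := Equiv.swap_apply_of_ne_of_ne hu.ne' hu'.ne'
    have hlt : ∀ x, x < m → Equiv.swap u u' x < m := by
      intro x hx
      rw [Equiv.swap_apply_def]
      split_ifs <;> assumption
    simp only [recordOrders, Finset.mem_filter, Finset.mem_univ, true_and, Equiv.coe_mulRight,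
      Equiv.Perm.mul_apply, hm, Equiv.swap_apply_left]
    refine and_congr_right fun _ => ⟨fun h x hx => h _ (hlt x hx), fun h x hx => ?_⟩
    simpa using h _ (hlt x hx)
  have h2 : ∑ u' ∈ Finset.Iio m, (recordOrders rank b m u').card =
      (Finset.univ.filter fun σ : Equiv.Perm (Fin n) => σ m = b).card := by
    rw [← Finset.card_biUnion]
    · congr 1
      ext σ
      simp only [recordOrders, Finset.mem_biUnion, Finset.mem_filter, Finset.mem_univ, true_and,
        Finset.mem_Iio]
      constructor
      · rintro ⟨_, _, h, _⟩
        exact h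
      · intro h
        obtain ⟨x, hx, hmax⟩ := (Finset.Iio m).exists_max_image (fun x => rank (σ x))
          ⟨u, Finset.mem_Iio.2 hu⟩
        exact ⟨x, Finset.mem_Iio.1 hx, h, fun y hy => hmax y (Finset.mem_Iio.2 hy)⟩
    · intro x hx y hy hxy
      rw [Function.onFun, Finset.disjoint_left]
      intro σ h1 h2
      simp only [recordOrders, Finset.mem_filter, Finset.mem_univ, true_and] at h1 h2
      simp only [Finset.coe_Iio, Set.mem_Iio] at hx hy
      exact hxy (σ.injective (hrank (le_antisymm (h2.2 x hx) (h1.2 y hy))))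
  rw [Finset.sum_congr rfl h, Finset.sum_const, Fin.card_Iio, smul_eq_mul] at h2
  rw [h2, card_perm_apply_eq]

end Secretary

namespace Mechanism

variable {n : ℕ} {I : Instance n}

/-- When the best agent preceding `b` lies in the sample, nobody between the sample and `b` reaches
the sample's maximum; injectivity of the ranking excludes ties. -/
theorem dynkin_winners_eq_of_mem_recordOrders (C : Choices I) {b m u : Fin n}
    (hb : ∀ i, C.rank i ≤ C.rank b) {σ : Equiv.Perm (Fin n)}
    (hσ : σ ∈ recordOrders C.rank b m u) (hu : (u : ℕ) < ⌊(n : ℝ) / Real.exp 1⌋₊)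
    (hm : ⌊(n : ℝ) / Real.exp 1⌋₊ ≤ (m : ℕ)) : (dynkin C σ).winners = {b} := by
  simp only [recordOrders, Finset.mem_filter, Finset.mem_univ, true_and] at hσ
  obtain ⟨h1, h2⟩ := hσ
  simp only [dynkin]
  set r := ⌊(n : ℝ) / Real.exp 1⌋₊
  suffices h : ((arrivals σ).drop r).find?
      (fun j => decide (∀ i ∈ (arrivals σ).take r, C.rank i ≤ C.rank j)) = some b by
    rw [h]; rfl
  rw [List.find?_eq_some_iff_getElem]
  refine ⟨by simpa using fun i _ => hb i, m - r, by simp [arrivals]; omega, ?_, ?_⟩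
  · simp only [arrivals, List.getElem_drop, List.getElem_ofFn]
    rw [← h1]
    congr 1
    ext
    simp
    omega
  · intro j hj
    have hjn : r + j < n := by omega
    simp only [arrivals, List.getElem_drop, List.getElem_ofFn, Bool.not_eq_true', decide_eq_false_iff_not]
    intro hall
    have h3 := hall (σ u) (by
      rw [List.mem_take_iff_getElem]
      exact ⟨u, by simp [hu], by simp⟩)
    have h4 := h2 ⟨r + j, hjn⟩ (by rw [Fin.lt_def]; simp; omega)
    have h5 := σ.injective (C.rank_injective (le_antisymm h3 h4))
    rw [Fin.ext_iff] at h5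
    simp at h5
    omega

/-- For `n ≤ 2` the sample is empty and the first arrival passes the test vacuously. She is the best
with probability `1/n`, which exceeds `1/e` because `n < e`. -/
theorem dynkin_winners_eq_of_floor_eq_zero (C : Choices I) {σ : Equiv.Perm (Fin n)}
    (h : ⌊(n : ℝ) / Real.exp 1⌋₊ = 0) (m : Fin n) (hm : (m : ℕ) = 0) :
    (dynkin C σ).winners = {σ m} := by
  have hn : 0 < n := m.pos
  obtain ⟨n, rfl⟩ : ∃ k, n = k + 1 := ⟨n - 1, by omega⟩
  obtain rfl : m = 0 := Fin.ext hm
  simp only [dynkin, h]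
  simp [arrivals]

/-- Dynkin's algorithm hires the highest ranked agent with probability at least `1/e`. -/
theorem card_dynkin_winners_eq (C : Choices I) {b : Fin n} (hb : ∀ i, C.rank i ≤ C.rank b) :
    1 / Real.exp 1 * n.factorial ≤ ((Finset.univ.filter fun σ : Equiv.Perm (Fin n) =>
      (dynkin C σ).winners = {b}).card : ℝ) := by
  have hn : 0 < n := b.pos
  have hn' : (0 : ℝ) < n := by exact_mod_cast hn
  have he := Real.exp_pos 1
  have hle : 1 / Real.exp 1 ≤ 0.4 := by
    rw [div_le_iff₀ he]; linarith [Real.exp_one_gt_d9]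
  set r := ⌊(n : ℝ) / Real.exp 1⌋₊ with hr
  rcases Nat.eq_zero_or_pos r with h0 | hpos
  · have h1 := card_perm_apply_eq (⟨0, hn⟩ : Fin n) b
    have hsub : (Finset.univ.filter fun σ : Equiv.Perm (Fin n) => σ ⟨0, hn⟩ = b) ⊆
        Finset.univ.filter fun σ : Equiv.Perm (Fin n) => (dynkin C σ).winners = {b} := by
      intro σ
      simp only [Finset.mem_filter, Finset.mem_univ, true_and]
      rintro h
      rw [dynkin_winners_eq_of_floor_eq_zero C h0 ⟨0, hn⟩ rfl, h]
    have hcard := Finset.card_le_card hsub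
    have hn2 : (n : ℝ) / Real.exp 1 < 1 := by simpa using Nat.floor_eq_zero.1 h0
    rw [div_lt_one he] at hn2
    rw [← h1]
    push_cast
    rw [← mul_assoc]
    have h3 : 1 / Real.exp 1 * (n : ℝ) ≤ 1 := by
      rw [one_div_mul_eq_div, div_le_one he]; exact hn2.le
    calc _ ≤ 1 * ((Finset.univ.filter fun σ : Equiv.Perm (Fin n) => σ ⟨0, hn⟩ = b).card : ℝ) := by
          gcongr
      _ ≤ _ := by rw [one_mul]; exact_mod_cast hcard
  -- The times `m` of the best agent and `u` of the best one before her, with `u < r ≤ m`. These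
  -- disjoint events have probability `1/(nm)` each; summing over the `r` values of `u` gives `(r/n)
  -- ∑ 1/m`.
  · let J := (Finset.univ : Finset (Fin n × Fin n)).filter fun x => r ≤ (x.1 : ℕ) ∧ (x.2 : ℕ) < r
    have hcard : ∑ x ∈ J, (recordOrders C.rank b x.1 x.2).card ≤
        (Finset.univ.filter fun σ : Equiv.Perm (Fin n) => (dynkin C σ).winners = {b}).card := by
      rw [← Finset.card_biUnion]
      · apply Finset.card_le_card
        intro σ hσ
        simp only [Finset.mem_biUnion] at hσ
        obtain ⟨x, hx, hσ⟩ := hσ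
        simp only [J, Finset.mem_filter, Finset.mem_univ, true_and] at hx ⊢
        exact dynkin_winners_eq_of_mem_recordOrders C hb hσ hx.2 hx.1
      · rintro ⟨m, u⟩ hx ⟨m', u'⟩ hy hxy
        rw [Function.onFun, Finset.disjoint_left]
        intro σ h1 h2
        simp only [J, recordOrders, Finset.coe_filter, Set.mem_ofPred_eq, Finset.mem_filter, Finset.mem_univ,
          true_and] at h1 h2 hx hy
        obtain rfl : m = m' := σ.injective (h1.1.trans h2.1.symm)
        refine hxy (Prod.ext rfl (σ.injective (C.rank_injective (le_antisymm (h2.2 u ?_) (h1.2 u' ?_)))))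
        · rw [Fin.lt_def]; omega
        · rw [Fin.lt_def]; omega
    have hsum : ∑ x ∈ J, ((recordOrders C.rank b x.1 x.2).card : ℝ) =
        n.factorial * (r / n * ∑ m ∈ Finset.Ico r n, 1 / (m : ℝ)) := by
      have hrn : r ≤ n := by
        have : (r : ℝ) ≤ n := by
          refine (Nat.floor_le (by positivity)).trans (div_le_self hn'.le ?_)
          exact Real.one_le_exp zero_le_one
        exact_mod_cast this
      have h1 : ∀ x ∈ J, ((recordOrders C.rank b x.1 x.2).card : ℝ) =
          n.factorial * (1 / n) * (1 / ((x.1 : ℕ) : ℝ)) := by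
        intro x hx
        simp only [J, Finset.mem_filter, Finset.mem_univ, true_and] at hx
        have h2 := card_recordOrders C.rank_injective b (m := x.1) (u := x.2)
          (by rw [Fin.lt_def]; omega)
        have hx1 : (0 : ℝ) < ((x.1 : ℕ) : ℝ) := by exact_mod_cast (by omega : 0 < (x.1 : ℕ))
        rw [← h2]
        push_cast
        field_simp
      rw [Finset.sum_congr rfl h1, ← Finset.mul_sum]
      have hJ : J = (Finset.univ.filter fun m : Fin n => r ≤ (m : ℕ)) ×ˢ
          (Finset.univ.filter fun u : Fin n => (u : ℕ) < r) := by
        ext x; simp [J]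
      have h3 : ∑ m ∈ (Finset.univ : Finset (Fin n)).filter (fun m : Fin n => r ≤ (m : ℕ)), 1 / ((m : ℕ) : ℝ) =
          ∑ m ∈ Finset.Ico r n, 1 / (m : ℝ) := by
        rw [Finset.sum_filter, Fin.sum_univ_eq_sum_range (fun m => if r ≤ m then 1 / (m : ℝ) else 0),
          ← Finset.sum_filter]
        congr 1
        ext m
        simp
        omega
      rw [hJ, Finset.sum_product]
      simp only [Finset.sum_const, Fin.card_filter_val_lt, min_eq_right hrn, nsmul_eq_mul]
      rw [← Finset.mul_sum, h3]
      ring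
    have hge := floor_div_exp_mul_sum_ge hpos hr
    calc 1 / Real.exp 1 * n.factorial
        ≤ n.factorial * (r / n * ∑ m ∈ Finset.Ico r n, 1 / (m : ℝ)) := by
          rw [mul_comm]; gcongr
      _ = ∑ x ∈ J, ((recordOrders C.rank b x.1 x.2).card : ℝ) := hsum.symm
      _ ≤ _ := by exact_mod_cast hcard

/-- Dynkin's algorithm obtains in expectation a `1/e` fraction of the value of any single agent. -/
theorem dynkin_value_ge (C : Choices I) (i : Fin n) :
    1 / Real.exp 1 * I.v {i} ≤
      ∑ σ : Equiv.Perm (Fin n), 1 / (n.factorial : ℝ) * I.v (dynkin C σ).winners := by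
  obtain ⟨b, -, hb⟩ := Finset.univ.exists_max_image C.rank ⟨i, Finset.mem_univ i⟩
  have hib : I.v {i} ≤ I.v {b} := by
    by_contra h
    exact absurd (C.rank_lt b i (not_le.1 h)) (not_lt.2 (hb i (Finset.mem_univ i)))
  have h1 := card_dynkin_winners_eq C fun i => hb i (Finset.mem_univ i)
  have hfac : (0 : ℝ) < n.factorial := by positivity
  have hv := I.v_nonneg {b}
  rw [← Finset.mul_sum]
  have h2 : ((Finset.univ.filter fun σ : Equiv.Perm (Fin n) =>
      (dynkin C σ).winners = {b}).card : ℝ) * I.v {b} ≤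
      ∑ σ : Equiv.Perm (Fin n), I.v (dynkin C σ).winners := by
    rw [← nsmul_eq_mul, ← Finset.sum_const]
    refine le_trans (Finset.sum_le_sum fun σ hσ => ?_)
      (Finset.sum_le_sum_of_subset_of_nonneg (Finset.filter_subset _ _) fun σ _ _ => I.v_nonneg _)
    rw [(Finset.mem_filter.1 hσ).2]
  calc 1 / Real.exp 1 * I.v {i} ≤ 1 / Real.exp 1 * I.v {b} := by gcongr
    _ = 1 / n.factorial * ((1 / Real.exp 1 * n.factorial) * I.v {b}) := by field_simp
    _ ≤ 1 / n.factorial * (((Finset.univ.filter fun σ : Equiv.Perm (Fin n) =>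
      (dynkin C σ).winners = {b}).card : ℝ) * I.v {b}) := by gcongr
    _ ≤ _ := by gcongr

end Mechanism

/-! ### Expected value of the mechanism. -/

namespace Mechanism

variable {n : ℕ} {I : Instance n}

theorem binomialWeight_nonneg {k : ℝ} (hk : 1 ≤ k) (ξ : ℕ) : 0 ≤ binomialWeight n k ξ := by
  have h1 : 1 / k ≤ 1 := by rw [div_le_one (by linarith)]; exact hk
  have h2 : 0 ≤ 1 - 1 / k := by linarith
  have h3 : 0 < k := by linarith
  unfold binomialWeight
  positivity

theorem expectedValue_eq (P : Params) (C : Choices I) (ω : ℝ) :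
    expectedValue P C ω =
      P.q * (∑ σ : Equiv.Perm (Fin n), 1 / (n.factorial : ℝ) * I.v (dynkin C σ).winners) +
      (1 - P.q) * ∑ σ : Equiv.Perm (Fin n), 1 / (n.factorial : ℝ) *
        ∑ ξ ∈ Finset.range (n + 1), binomialWeight n P.k ξ *
          ∑ j : Fin 2, (1 / 2 : ℝ) * I.v (posted P C ω σ ξ j).winners := by
  rw [expectedValue, Finset.mul_sum, Finset.mul_sum, ← Finset.sum_add_distrib]
  exact Finset.sum_congr rfl fun σ _ => by ring

theorem posted_expectation_nonneg {P : Params} (hk : 1 ≤ P.k) (C : Choices I) (ω : ℝ) :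
    0 ≤ ∑ σ : Equiv.Perm (Fin n), 1 / (n.factorial : ℝ) *
        ∑ ξ ∈ Finset.range (n + 1), binomialWeight n P.k ξ *
          ∑ j : Fin 2, (1 / 2 : ℝ) * I.v (posted P C ω σ ξ j).winners :=
  Finset.sum_nonneg fun _ _ => mul_nonneg (by positivity) (Finset.sum_nonneg fun _ _ =>
    mul_nonneg (binomialWeight_nonneg hk _) (Finset.sum_nonneg fun _ _ =>
      mul_nonneg (by norm_num) (I.v_nonneg _)))

theorem dynkin_expectation_nonneg (C : Choices I) :
    0 ≤ ∑ σ : Equiv.Perm (Fin n), 1 / (n.factorial : ℝ) * I.v (dynkin C σ).winners :=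
  Finset.sum_nonneg fun _ _ => mul_nonneg (by positivity) (I.v_nonneg _)

theorem expectedValue_nonneg {P : Params} (hq0 : 0 ≤ P.q) (hq1 : P.q ≤ 1) (hk : 1 ≤ P.k)
    (C : Choices I) (ω : ℝ) : 0 ≤ expectedValue P C ω := by
  rw [expectedValue_eq]
  exact add_nonneg (mul_nonneg hq0 (dynkin_expectation_nonneg C))
    (mul_nonneg (by linarith) (posted_expectation_nonneg hk C ω))

/-- A lower bound on the posted-price branch that depends only on the sample carries over to the
expectation. -/
theorem posted_expectation_ge {P : Params} (hk : 1 ≤ P.k) (C : Choices I) (ω : ℝ)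
    (g : Finset (Fin n) → ℝ)
    (hg : ∀ (σ : Equiv.Perm (Fin n)) (ξ : ℕ), g ((arrivals σ).take ξ).toFinset ≤
      ∑ j : Fin 2, (1 / 2 : ℝ) * I.v (posted P C ω σ ξ j).winners) :
    ∑ A : Finset (Fin n), bernoulliWeight (1 / P.k) A * g A ≤
      ∑ σ : Equiv.Perm (Fin n), 1 / (n.factorial : ℝ) *
        ∑ ξ ∈ Finset.range (n + 1), binomialWeight n P.k ξ *
          ∑ j : Fin 2, (1 / 2 : ℝ) * I.v (posted P C ω σ ξ j).winners := by
  rw [← sum_binomialWeight_take]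
  gcongr with σ _ ξ _
  · exact binomialWeight_nonneg hk ξ
  · exact hg σ ξ

/-- A nonnegative modular minorant of `v` that is exact on the optimal solution. -/
theorem exists_optimal_weights {S : Finset (Fin n)} (hS : I.IsOptimal S) {V : ℝ}
    (hV0 : 0 ≤ V) (hV : ∀ i, I.v {i} ≤ V) :
    ∃ w : Fin n → ℝ, (∀ i, 0 ≤ w i) ∧ (∀ i, w i ≤ V) ∧ ∑ i, w i = I.v S ∧
      ∀ A : Finset (Fin n), ∑ i ∈ A, w i ≤ I.v (S ∩ A) := by
  obtain ⟨w, h1, h2, h3⟩ := I.exists_modular_minorant S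
  have hsum : ∀ A : Finset (Fin n), (∑ i ∈ A, if i ∈ S then w i else 0) = ∑ i ∈ S ∩ A, w i := by
    intro A
    rw [← Finset.sum_filter, Finset.filter_mem_eq_inter, Finset.inter_comm]
  refine ⟨fun i => if i ∈ S then w i else 0, fun i => ?_, fun i => ?_, ?_, fun A => ?_⟩
  · dsimp only
    split_ifs with hi
    -- Deleting `i` keeps `S` affordable, so by optimality it cannot raise the value; hence `wᵢ ≥
    -- v(S) - v(S \ {i}) ≥ 0`.
    · have := hS.2 _ (hS.1.mono (Finset.erase_subset i S))
      linarith [(h3 i hi).1]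
    · exact le_rfl
  · dsimp only
    split_ifs with hi
    · exact (h3 i hi).2.trans (hV i)
    · exact hV0
  · rw [hsum, Finset.inter_univ, h1]
  · rw [hsum]
    exact h2 _ Finset.inter_subset_left

open Classical in
/-- The posted-price branch when no single agent is too valuable. -/
theorem posted_expectation_ge_pTilde {P : Params} {δ z ε : ℝ} (hβ : 0 ≤ P.β)
    (hk : 1 < P.k) (hδ : 0 < δ) (hz : 0 < z) (hL : 0 < level P δ ε) (C : Choices I)
    {S : Finset (Fin n)} (hS : I.IsOptimal S) (hS0 : 0 < I.v S)
    (hV : ∀ i, I.v {i} ≤ 1 / z * level P δ ε * I.v S)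
    (hc : 0 ≤ min (1 / 4 * ((P.k - 1) / P.k - δ) - 1 / 2 * (P.a * (1 - ε) + P.β))
        ((z - 1) / (2 * z) * level P δ ε)) :
    pTilde P δ z ε * min (1 / 4 * ((P.k - 1) / P.k - δ) - 1 / 2 * (P.a * (1 - ε) + P.β))
        ((z - 1) / (2 * z) * level P δ ε) * I.v S ≤
      ∑ σ : Equiv.Perm (Fin n), 1 / (n.factorial : ℝ) *
        ∑ ξ ∈ Finset.range (n + 1), binomialWeight n P.k ξ *
          ∑ j : Fin 2, (1 / 2 : ℝ) * I.v (posted P C ((1 - ε) * I.v S) σ ξ j).winners := by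
  have hk0 : 0 < P.k := by linarith
  have hp0 : 0 < 1 / P.k := by positivity
  have hp1 : 1 / P.k < 1 := by rw [div_lt_one hk0]; exact hk
  set c := min (1 / 4 * ((P.k - 1) / P.k - δ) - 1 / 2 * (P.a * (1 - ε) + P.β))
        ((z - 1) / (2 * z) * level P δ ε) with hcdef
  set M := 1 / z * level P δ ε * I.v S with hM
  have hMpos : 0 < M := by positivity
  obtain ⟨w, hw0, hwM, hW, hwA⟩ := exists_optimal_weights hS hMpos.le hV
  have hbern := bernoulli_two_sided hp0 hp1 hw0 hwM hW hMpos hS0 hδ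
  -- With `W = v(S)` and `M` proportional to `v(S)`, the value of the optimum cancels and the
  -- exponent of `pTilde` remains.
  have hexp : (δ * I.v S) ^ 2 / (2 * (1 / P.k * (1 - 1 / P.k) * M * I.v S + M * (δ * I.v S) / 3)) =
      (δ ^ 2 / 2) / (((P.k - 1) / P.k ^ 2 + δ / 3) * (1 / z) * level P δ ε) := by
    have e1 : 2 * (1 / P.k * (1 - 1 / P.k) * M * I.v S + M * (δ * I.v S) / 3) =
        2 * (((P.k - 1) / P.k ^ 2 + δ / 3) * (1 / z) * level P δ ε) * I.v S ^ 2 := by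
      rw [hM]; field_simp
    rw [e1, mul_pow, mul_div_mul_right _ _ (by positivity), div_div]
  rw [hexp] at hbern
  have hbern' : pTilde P δ z ε ≤ _ := hbern
  let good : Finset (Fin n) → Prop := fun A =>
    (1 / P.k - δ) * I.v S ≤ ∑ i ∈ A, w i ∧ (1 - 1 / P.k - δ) * I.v S ≤ ∑ i ∈ Aᶜ, w i
  refine le_trans ?_ (posted_expectation_ge hk.le C _
    -- Samples that are not good contribute at least `0`, as `v` is non-negative.
    (fun A => if good A then c * I.v S else 0) fun σ ξ => ?_)
  · calc pTilde P δ z ε * c * I.v S = pTilde P δ z ε * (c * I.v S) := by ring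
      _ ≤ _ := mul_le_mul_of_nonneg_right hbern' (by positivity)
      _ = _ := by
        rw [Finset.sum_mul]
        refine Finset.sum_congr rfl fun A _ => ?_
        simp only [good]
        split_ifs <;> ring
  · split_ifs with hA
    · obtain ⟨hA1, hA2⟩ := hA
      set A := ((arrivals σ).take ξ).toFinset with hAdef
      obtain ⟨hT1, hT2, hT3⟩ := C.approx_spec A
      have he := Real.exp_pos 1
      have hTub := hS.2 _ hT2
      have hTlb : 1 / Real.exp 1 * ((1 / P.k - δ) * I.v S) ≤ I.v (C.approx A) := by
        refine le_trans ?_ (hT3 (S ∩ A) Finset.inter_subset_right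
          (hS.1.mono Finset.inter_subset_left))
        gcongr
        exact hA1.trans (hwA A)
      have htlb : level P δ ε * I.v S ≤ threshold P C ((1 - ε) * I.v S) σ ξ := by
        have := mul_le_mul_of_nonneg_left hTlb hβ
        rw [threshold, level, ← hAdef]
        calc _ = P.a * ((1 - ε) * I.v S) +
              P.β * (1 / Real.exp 1 * ((1 / P.k - δ) * I.v S)) := by ring
          _ ≤ _ := by linarith
      have htub : threshold P C ((1 - ε) * I.v S) σ ξ ≤ (P.a * (1 - ε) + P.β) * I.v S := by
        have := mul_le_mul_of_nonneg_left hTub hβ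
        rw [threshold, ← hAdef]
        linarith
      refine le_trans ?_ (posted_value_ge P C _ σ ξ hS.1 hV
        (lt_of_lt_of_le (by positivity) htlb))
      rw [← hAdef]
      have hO := hA2.trans (hwA Aᶜ)
      refine le_min ?_ ?_
      · have h1 : c * I.v S ≤ (1 / 4 * ((P.k - 1) / P.k - δ) -
            1 / 2 * (P.a * (1 - ε) + P.β)) * I.v S := by
          gcongr
          exact min_le_left _ _
        have h2 : (P.k - 1) / P.k = 1 - 1 / P.k := by field_simp
        rw [h2] at h1
        linarith
      · have h1 : c * I.v S ≤ ((z - 1) / (2 * z) * level P δ ε) * I.v S := by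
          gcongr
          exact min_le_right _ _
        have h2 : ((z - 1) / (2 * z) * level P δ ε) * I.v S =
            1 / 2 * (level P δ ε * I.v S - M) := by
          rw [hM]; field_simp
        linarith
    · exact Finset.sum_nonneg fun _ _ => mul_nonneg (by norm_num) (I.v_nonneg _)

theorem guarantee_mul_le_expectedValue {P : Params} {δ z ε : ℝ} (hq0 : 0 ≤ P.q) (hq1 : P.q ≤ 1)
    (ha : 0 ≤ P.a) (hβ : 0 ≤ P.β) (hk : 1 ≤ P.k) (hδ : 0 < δ) (hz : 0 < z) (hε1 : ε < 1)
    (hp : 0 ≤ pTilde P δ z ε) (C : Choices I) {S : Finset (Fin n)} (hS : I.IsOptimal S) :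
    guarantee P δ z ε * I.v S ≤ expectedValue P C ((1 - ε) * I.v S) := by
  have hE := expectedValue_nonneg hq0 hq1 hk C ((1 - ε) * I.v S)
  -- A non-positive guarantee is trivial. A positive one forces `level P δ ε` and the inner minimum
  -- to be positive, which the concentration argument needs.
  rcases le_or_gt (guarantee P δ z ε) 0 with h0 | hpos
  · exact (mul_nonpos_of_nonpos_of_nonneg h0 (I.v_nonneg S)).trans hE
  rcases (I.v_nonneg S).eq_or_lt with h0 | hS0
  · simpa [← h0] using hE
  obtain ⟨hpos1, hpos2⟩ := lt_min_iff.1 hpos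
  have he := Real.exp_pos 1
  have hL : 0 < level P δ ε := pos_of_mul_pos_right hpos1 (by positivity)
  have hc := pos_of_mul_pos_right hpos2 (mul_nonneg (by linarith) hp)
  rw [expectedValue_eq]
  have hq : 0 ≤ 1 - P.q := by linarith
  have hD := dynkin_expectation_nonneg C
  have hQ := posted_expectation_nonneg hk C ((1 - ε) * I.v S)
  by_cases hV : ∀ i, I.v {i} ≤ 1 / z * level P δ ε * I.v S
  -- At `k = 1` the first entry of the inner minimum is at most `-δ/4`, so the guarantee could not
  -- be positive.
  · have hk1 : 1 < P.k := by
      refine hk.lt_of_ne fun h => ?_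
      have h1 := hc.trans_le (min_le_left _ _)
      rw [← h] at h1
      have : 0 ≤ P.a * (1 - ε) := mul_nonneg ha (by linarith)
      linarith
    have h := posted_expectation_ge_pTilde hβ hk1 hδ hz hL C hS hS0 hV hc.le
    have h2 := mul_le_mul_of_nonneg_left h hq
    refine le_trans ?_ (le_add_of_nonneg_left (mul_nonneg hq0 hD))
    refine le_trans ?_ h2
    rw [← mul_assoc, ← mul_assoc]
    exact mul_le_mul_of_nonneg_right (min_le_right _ _) hS0.le
  · push Not at hV
    obtain ⟨i, hi⟩ := hV
    refine le_trans ?_ (le_add_of_nonneg_right (mul_nonneg hq hQ))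
    calc guarantee P δ z ε * I.v S
        ≤ P.q / (Real.exp 1 * z) * level P δ ε * I.v S :=
          mul_le_mul_of_nonneg_right (min_le_left _ _) hS0.le
      _ = P.q * (1 / Real.exp 1 * (1 / z * level P δ ε * I.v S)) := by field_simp
      _ ≤ P.q * (1 / Real.exp 1 * I.v {i}) := by gcongr
      _ ≤ _ := by gcongr; exact dynkin_value_ge C i

/-! ### Numerical evaluation at the recommended parameters. -/

section Parameters

/-- The recommended parameters. -/
def tuned : Params := { q := 0.61, a := 0.035, β := 0.155, k := 2.5 }

theorem level_tuned (ε : ℝ) :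
    level tuned 0.164 ε = 0.035 * (1 - ε) + 0.03658 * (1 / Real.exp 1) := by
  norm_num [level, tuned]
  ring

theorem one_div_exp_one_bounds :
    0.36787944 ≤ 1 / Real.exp 1 ∧ 1 / Real.exp 1 ≤ 0.36787945 := by
  have h1 := Real.exp_one_gt_d9
  have h2 := Real.exp_one_lt_d9
  have he := Real.exp_pos 1
  rw [le_div_iff₀ he, div_le_iff₀ he]
  constructor <;> linarith

theorem pTilde_tuned_ge {ε : ℝ} (hε0 : 0 ≤ ε) (hε1 : ε < 1) :
    0.8036 ≤ pTilde tuned 0.164 2.47 ε := by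
  obtain ⟨h1, h2⟩ := one_div_exp_one_bounds
  have hL := level_tuned ε
  unfold pTilde
  set L := level tuned 0.164 ε
  have hL0 : 0 < L := by rw [hL]; linarith
  -- `pTilde` decreases in `L`, and `L` is largest at `ε = 0`; hence one constant serves for all
  -- `ε`.
  have hL1 : L ≤ 0.04845704 := by rw [hL]; linarith
  have harg : 2.326 ≤ (0.164 ^ 2 / 2) / (((tuned.k - 1) / tuned.k ^ 2 + 0.164 / 3) * (1 / 2.47) * L) := by
    norm_num [tuned]
    rw [le_div_iff₀ (by positivity)]
    linarith
  have hexp : Real.exp (-(2.326 : ℝ)) ≤ 0.0982 := by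
    have h3 : (10.19 : ℝ) ≤ Real.exp 2.326 := by
      have h4 : Real.exp 2.326 = Real.exp 1 * Real.exp 1 * Real.exp 0.326 := by
        rw [← Real.exp_add, ← Real.exp_add]; norm_num
      have h5 := Real.quadratic_le_exp_of_nonneg (x := 0.326) (by norm_num)
      have h6 := Real.exp_one_gt_d9
      rw [h4]
      calc (10.19 : ℝ) ≤ 2.7182818283 * 2.7182818283 * (1 + 0.326 + 0.326 ^ 2 / 2) := by norm_num
        _ ≤ _ := by gcongr
    rw [Real.exp_neg, inv_le_comm₀ (Real.exp_pos _) (by norm_num)]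
    norm_num at h3 ⊢
    linarith
  have h3 := (Real.exp_le_exp.2 (neg_le_neg harg)).trans hexp
  linarith

theorem le_guarantee_tuned_zero : 1 / 228 ≤ guarantee tuned 0.164 2.47 0 := by
  obtain ⟨h1, h2⟩ := one_div_exp_one_bounds
  have hL := level_tuned 0
  have hp := pTilde_tuned_ge le_rfl zero_lt_one
  unfold guarantee
  set L := level tuned 0.164 0
  have hL0 : 0.048457 ≤ L := by rw [hL]; linarith
  refine le_min ?_ ?_
  · have e : tuned.q / (Real.exp 1 * 2.47) * L = 0.61 / 2.47 * ((1 / Real.exp 1) * L) := by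
      simp only [tuned]; field_simp
    rw [e]
    have : 0.36787944 * 0.048457 ≤ 1 / Real.exp 1 * L := by gcongr
    linarith
  · have hmin : 0.014 ≤ min (1 / 4 * ((tuned.k - 1) / tuned.k - 0.164) -
        1 / 2 * (tuned.a * (1 - 0) + tuned.β)) ((2.47 - 1) / (2 * 2.47) * L) := by
      refine le_min ?_ ?_
      · norm_num [tuned]
      · linarith
    have : (1 - tuned.q) * 0.8036 * 0.014 ≤ (1 - tuned.q) * pTilde tuned 0.164 2.47 0 *
        min (1 / 4 * ((tuned.k - 1) / tuned.k - 0.164) -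
        1 / 2 * (tuned.a * (1 - 0) + tuned.β)) ((2.47 - 1) / (2 * 2.47) * L) := by
      have : 0 ≤ 1 - tuned.q := by norm_num [tuned]
      gcongr
    refine le_trans ?_ this
    norm_num [tuned]

theorem le_guarantee_tuned {ε : ℝ} (hε0 : 0 ≤ ε) (hε1 : ε < 1) :
    1 / 818 ≤ guarantee tuned 0.164 2.47 ε := by
  obtain ⟨h1, h2⟩ := one_div_exp_one_bounds
  have hL := level_tuned ε
  have hp := pTilde_tuned_ge hε0 hε1
  unfold guarantee
  set L := level tuned 0.164 ε
  -- The limit `ε → 1` is the worst case: only the sample's share `0.03658/e` of `L` survives there.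
  have hL0 : 0.01345702 ≤ L := by rw [hL]; linarith
  refine le_min ?_ ?_
  · have e : tuned.q / (Real.exp 1 * 2.47) * L = 0.61 / 2.47 * ((1 / Real.exp 1) * L) := by
      simp only [tuned]; field_simp
    rw [e]
    have : 0.36787944 * 0.01345702 ≤ 1 / Real.exp 1 * L := by gcongr
    linarith
  · have hmin : 0.004 ≤ min (1 / 4 * ((tuned.k - 1) / tuned.k - 0.164) -
        1 / 2 * (tuned.a * (1 - ε) + tuned.β)) ((2.47 - 1) / (2 * 2.47) * L) := by
      refine le_min ?_ ?_
      · norm_num [tuned]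
        linarith
      · linarith
    have : (1 - tuned.q) * 0.8036 * 0.004 ≤ (1 - tuned.q) * pTilde tuned 0.164 2.47 ε *
        min (1 / 4 * ((tuned.k - 1) / tuned.k - 0.164) -
        1 / 2 * (tuned.a * (1 - ε) + tuned.β)) ((2.47 - 1) / (2 * 2.47) * L) := by
      have : 0 ≤ 1 - tuned.q := by norm_num [tuned]
      gcongr
    refine le_trans ?_ this
    norm_num [tuned]

theorem tuned_value_ge (C : Choices I) {S : Finset (Fin n)} (hS : I.IsOptimal S) {ε r : ℝ}
    (hε0 : 0 ≤ ε) (hε1 : ε < 1) (hr : 0 < r) (h : 1 / r ≤ guarantee tuned 0.164 2.47 ε) :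
    I.v S ≤ r * expectedValue tuned C ((1 - ε) * I.v S) := by
  have hp := pTilde_tuned_ge hε0 hε1
  have h1 := guarantee_mul_le_expectedValue (P := tuned) (δ := 0.164) (z := 2.47)
    (by norm_num [tuned]) (by norm_num [tuned]) (by norm_num [tuned]) (by norm_num [tuned])
    (by norm_num [tuned]) (by norm_num) (by norm_num) hε1 (by linarith) C hS
  have h2 := (mul_le_mul_of_nonneg_right h (I.v_nonneg S)).trans h1
  rwa [one_div_mul_eq_div, div_le_iff₀' hr] at h2

theorem isConsistent_tuned : IsConsistent tuned 228 := by
  intro n I C S hS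
  simpa using tuned_value_ge C hS le_rfl zero_lt_one (by norm_num) le_guarantee_tuned_zero

theorem isRobust_tuned : IsRobust tuned 818 := by
  intro n I C S hS ω hω0 hω1
  have hS0 : 0 < I.v S := hω0.trans_le hω1
  -- Any `ω ∈ (0, v(S*)]` equals `(1 - ε) v(S*)` for `ε = 1 - ω/v(S*)`.
  have hε0 : 0 ≤ 1 - ω / I.v S := by
    rw [sub_nonneg, div_le_one hS0]; exact hω1
  have hε1 : 1 - ω / I.v S < 1 := by
    have : 0 < ω / I.v S := by positivity
    linarith
  have h := tuned_value_ge C hS hε0 hε1 (by norm_num) (le_guarantee_tuned hε0 hε1)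
  rwa [sub_sub_cancel, div_mul_cancel₀ _ hS0.ne'] at h

end Parameters

end Mechanism

theorem mainTheorem8 :
    (∀ (P : Params) (δ z ε : ℝ), 0 ≤ P.q → P.q ≤ 1 → 0 ≤ P.a → 0 ≤ P.β → 1 ≤ P.k →
      0 < δ → 0 < z → 0 ≤ ε → ε < 1 → 0 ≤ Mechanism.pTilde P δ z ε →
      ∀ (n : ℕ) (I : Instance n) (C : Choices I) (Sopt : Finset (Fin n)), I.IsOptimal Sopt →
        Mechanism.guarantee P δ z ε * I.v Sopt ≤
          Mechanism.expectedValue P C ((1 - ε) * I.v Sopt)) ∧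
    (∀ P : Params, P = { q := 0.61, a := 0.035, β := 0.155, k := 2.5 } →
      1 / 228 ≤ Mechanism.guarantee P 0.164 2.47 0 ∧
      (∀ ε : ℝ, 0 ≤ ε → ε < 1 → 1 / 818 ≤ Mechanism.guarantee P 0.164 2.47 ε) ∧
      Mechanism.IsConsistent P 228 ∧ Mechanism.IsRobust P 818) := by
  refine ⟨fun P δ z ε hq0 hq1 ha hβ hk hδ hz _ hε1 hp n I C S hS =>
    Mechanism.guarantee_mul_le_expectedValue hq0 hq1 ha hβ hk hδ hz hε1 hp C hS, ?_⟩
  rintro P rfl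
  exact ⟨Mechanism.le_guarantee_tuned_zero, fun ε => Mechanism.le_guarantee_tuned,
    Mechanism.isConsistent_tuned, Mechanism.isRobust_tuned⟩
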